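/- Throughout, $X$ is a complex Banach space, and for $0<\theta<\pi$ let $S_\theta=\{z\in\mathbb C: z\ne0,\ |\arg z|<\theta\}$. A densely defined linear operator $A$ on $X$ belongs to $\operatorname{Sect}(\omega)$, where $0<\omega<\pi$, if $\sigma(A)\subset\overline{S_\omega}$ and $\sup\{\|z(z-A)^{-1}\|: z\notin\overline{S_\omega}\}<\infty$. Let $H_0^\infty(S_\psi)$ (respectively $\mathcal B(S_\psi)$) be the set of holomorphic $f$ on $S_\psi$ with $|f(z)|\le C\min(|z|^s,|z|^{-s})$ (respectively $|f(z)|\le C\max(|z|^s,|z|^{-s})$) on $S_\psi$ for some $C,s>0$. For $f\in H_0^\infty(S_\psi)$ with $\omega<\psi<\pi$ put $$f(A)=\frac1{2\pi i}\int_\Gamma f(z)(z-A)^{-1}\,dz,$$ where $\Gamma$ is the downward oriented boundary of $S_\theta$ for any $\omega<\theta<\psi$. Let $A$ be injective. The extended holomorphic calculus is defined by $f(A)=e(A)^{-1}(ef)(A)$ for $f$ holomorphic on $S_\psi$, where $e\in H_0^\infty(S_\psi)$ is any function with $ef\in H_0^\infty(S_\psi)$ and $e(A)$ injective, if such an $e$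 exists (as it does for every $f\in\mathcal B(S_\psi)$); $f(A)$ depends neither on $\theta$ nor on $e$, and does not change when $f$ is restricted to a smaller sector $S_{\psi'}$, $\omega<\psi'<\psi$. Let $H(A)$ be the set of all $f\in\bigcup_{\omega<\psi<\pi}\mathcal B(S_\psi)$ such that $f(A)$ is a bounded operator defined on all of $X$. Products of operators have the domain $\operatorname{dom}(ST)=\{x\in\operatorname{dom}(T): Tx\in\operatorname{dom}(S)\}$. **Theorem.** Let $0<\omega<\varphi<\pi$, let $A\in\operatorname{Sect}(\omega)$ be injective, and let $f,g\in\mathcal B(S_\varphi)$. Assume that $f$ has no zeros in $S_\varphi$ and $1/f\in\mathcal B(S_\varphi)$, and that there exist $e_1,e_2,e_3\in H(A)$ and a complex polynomial $p$ with $p(0)\neq0$ such that 1. for $j=1,2,3$, $e_j$ has no zeros in $S_\varphi$ and $1/e_j\in\mathcal B(S_\varphi)$; 2. $e_1f\in H(A)$, $e_2g\in H(A)$ and $e_3/f\in H(A)$; 3. $\operatorname{ran}\big(p(e_3(A))\big)\subset\operatorname{ran}\big((e_1e_2)(A)\big)$. Then $f(A)g(A)=(fg)(A)$, as operators with equal domains.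 -/

import Mathlib

open Set

namespace SectCalc

/-- The open sector `S_φ` of half-angle `φ`, symmetric about the positive real axis. -/
def sector (φ : ℝ) : Set ℂ := {z | z ≠ 0 ∧ |z.arg| < φ}

/-- The closed sector of half-angle `ω`; it contains `0` since `Complex.arg 0 = 0`, and it is the
closure of `sector ω` for `0 < ω < π`. -/
def closedSector (ω : ℝ) : Set ℂ := {z | |z.arg| ≤ ω}

/-- The class `H_0^∞(S_φ)`. Functions on a sector are represented by functions on `ℂ`; only their
values on the sector matter. -/
def MemH0 (φ : ℝ) (f : ℂ → ℂ) : Prop :=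
  DifferentiableOn ℂ f (sector φ) ∧
    ∃ C > (0 : ℝ), ∃ s > (0 : ℝ), ∀ z ∈ sector φ, ‖f z‖ ≤ C * min (‖z‖ ^ s) (‖z‖ ^ (-s))

/-- The class `B(S_φ)` of holomorphic functions of polynomial growth at `0` and at infinity. -/
def MemB (φ : ℝ) (f : ℂ → ℂ) : Prop :=
  DifferentiableOn ℂ f (sector φ) ∧
    ∃ C > (0 : ℝ), ∃ s > (0 : ℝ), ∀ z ∈ sector φ, ‖f z‖ ≤ C * max (‖z‖ ^ s) (‖z‖ ^ (-s))

variable {X : Type*} [NormedAddCommGroup X] [NormedSpace ℂ X]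

/-- A bounded operator, viewed as an everywhere defined operator. -/
def ofCLM (T : X →L[ℂ] X) : X →ₗ.[ℂ] X := T.toLinearMap.toPMap ⊤

/-- The product (composition) `S T` of two operators, with domain
`{x ∈ dom T : T x ∈ dom S}`. -/
def mulPMap (S T : X →ₗ.[ℂ] X) : X →ₗ.[ℂ] X where
  domain := (S.domain.comap T.toFun).map T.domain.subtype
  toFun :=
    { toFun := fun x =>
        S ⟨T ⟨x, by obtain ⟨y, _, hy⟩ := x.2; exact hy ▸ y.2⟩, by
          obtain ⟨x, y, hy, rfl⟩ := x; exact hy⟩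
      map_add' := fun x y => by
        rw [← S.map_add]
        congr 1
        apply Subtype.ext
        exact T.map_add ⟨x, by obtain ⟨z, _, hz⟩ := x.2; exact hz ▸ z.2⟩
          ⟨y, by obtain ⟨z, _, hz⟩ := y.2; exact hz ▸ z.2⟩
      map_smul' := fun c x => by
        rw [RingHom.id_apply, ← S.map_smul]
        congr 1
        apply Subtype.ext
        exact T.map_smul c ⟨x, by obtain ⟨z, _, hz⟩ := x.2; exact hz ▸ z.2⟩ }

/-- `R` is the bounded two-sided inverse of `z - A`. -/
def IsResolvent (A : X →ₗ.[ℂ] X) (z : ℂ) (R : X →L[ℂ] X) : Prop :=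
  (∀ x : X, ∃ h : R x ∈ A.domain, z • R x - A ⟨R x, h⟩ = x) ∧
    ∀ x : A.domain, R (z • (x : X) - A x) = x

/-- The spectrum of an (in general unbounded) operator. -/
def spec (A : X →ₗ.[ℂ] X) : Set ℂ := {z | ¬ ∃ R, IsResolvent A z R}

open Classical in
/-- The resolvent `(z - A)⁻¹` for `z` outside the spectrum (and `0` on the spectrum). -/
noncomputable def res (A : X →ₗ.[ℂ] X) (z : ℂ) : X →L[ℂ] X :=
  if h : ∃ R, IsResolvent A z R then h.choose else 0

/-- `A ∈ Sect(ω)`: `A` is densely defined, its spectrum lies in the closed sector of half-angle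
`ω`, and `‖z (z - A)⁻¹‖` is bounded for `z` outside of it. -/
structure IsSect (ω : ℝ) (A : X →ₗ.[ℂ] X) : Prop where
  dense : Dense (A.domain : Set X)
  spec_subset : spec A ⊆ closedSector ω
  bound : ∃ M : ℝ, ∀ z ∉ closedSector ω, ‖z • res A z‖ ≤ M

/-- The Cauchy integral `(2πi)⁻¹ ∫_Γ f(z) (z - A)⁻¹ dz`, where `Γ` is the boundary of the sector
of half-angle `θ`, oriented downwards: it comes in along the ray of angle `θ` and goes out along
the ray of angle `-θ`. -/
noncomputable def cauchy (A : X →ₗ.[ℂ] X) (θ : ℝ) (f : ℂ → ℂ) : X →L[ℂ] X :=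
  let ray : ℝ → X →L[ℂ] X := fun α =>
    ∫ r in Ioi (0 : ℝ), (f (r * Complex.exp (α * Complex.I)) * Complex.exp (α * Complex.I)) •
      res A (r * Complex.exp (α * Complex.I))
  (2 * Real.pi * Complex.I)⁻¹ • (ray (-θ) - ray θ)

/-- A regulariser `e` for `f` in the primary calculus on some sector `S_ψ`, `ω < ψ < π`, that is
`e ∈ H_0^∞(S_ψ)`, `e f ∈ H_0^∞(S_ψ)` and `e(A)` is injective, together with the angle `θ` of an
integration contour. -/
structure Regulariser (ω : ℝ) (A : X →ₗ.[ℂ] X) (f : ℂ → ℂ) where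
  ψ : ℝ
  θ : ℝ
  e : ℂ → ℂ
  lt_θ : ω < θ
  θ_lt : θ < ψ
  ψ_lt : ψ < Real.pi
  holo : DifferentiableOn ℂ f (sector ψ)
  mem : MemH0 ψ e
  mem_mul : MemH0 ψ (e * f)
  inj : Function.Injective (cauchy A θ e)

/-- The operator `e(A)⁻¹ (e f)(A)` given by a regulariser `e` for `f`. -/
noncomputable def Regulariser.op {ω : ℝ} {A : X →ₗ.[ℂ] X} {f : ℂ → ℂ}
    (r : Regulariser ω A f) : X →ₗ.[ℂ] X :=
  mulPMap (ofCLM (cauchy A r.θ r.e)).inverse (ofCLM (cauchy A r.θ (r.e * f)))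

open Classical in
/-- The operator `f(A) = e(A)⁻¹ (e f)(A)` of the extended holomorphic calculus, where `e` is an
arbitrary regulariser for `f`. (If `f` has no regulariser, the value is a placeholder.) -/
noncomputable def holCalc (ω : ℝ) (A : X →ₗ.[ℂ] X) (f : ℂ → ℂ) : X →ₗ.[ℂ] X :=
  if h : Nonempty (Regulariser ω A f) then h.some.op else ⊥

/-- The class `H(A)`: `f` belongs to `B(S_ψ)` for some `ω < ψ < π`, and `f(A)` is a bounded
everywhere defined operator. -/
def MemHA (ω : ℝ) (A : X →ₗ.[ℂ] X) (f : ℂ → ℂ) : Prop :=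
  (∃ ψ, ω < ψ ∧ ψ < Real.pi ∧ MemB ψ f) ∧ ∃ T : X →L[ℂ] X, holCalc ω A f = ofCLM T

/-- For `f ∈ H(A)`, the operator `f(A)` as a bounded operator. -/
noncomputable def MemHA.op {ω : ℝ} {A : X →ₗ.[ℂ] X} {f : ℂ → ℂ} (h : MemHA ω A f) :
    X →L[ℂ] X := h.2.choose

end SectCalc

/-! The core is the product rule `mem_graph_holCalc_mul_iff`: once g(A)x = y is defined, (fg)(A)x
and f(A)y are defined together and agree. Hence f(A)g(A) ⊆ (fg)(A) always, and the theorem amounts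
to dom (fg)(A) ⊆ dom g(A).

Let x ∈ dom (fg)(A). Since (e₃/f)(A) is bounded, the rule gives x ∈ dom (e₃g)(A). By the range
condition p(e₃(A))x = (e₁e₂)(A)y = e₂(A)e₁(A)y for some y, and (e₂g)(A) is bounded, so g(A) is
defined at p(e₃(A))x, that is, x ∈ dom ((p∘e₃)g)(A) (`exists_mem_graph_mul_of_range_le`). Write p(z)
= p(0) + z q(z). Then p(0)g = (p∘e₃)g − (q∘e₃)(e₃g), where (q∘e₃)(A) is bounded, so x lies in the
domain of both terms; p(0) ≠ 0 gives x ∈ dom g(A) (`exists_mem_graph_of_mem_graph_mul`).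

The rest constructs the calculus. With z = exp v the sector becomes a strip, the rays become
horizontal lines, and H_0^∞ becomes exponential decay, so contour arguments reduce to one residue
theorem on a strip. It gives independence of the angle (`cauchy_eq_cauchy`), multiplicativity
through the resolvent identity and Fubini (`cauchy_mul_cauchy`), and a closed form for one rational
function of A (`IsSect.cauchy_basicReg`). Injectivity of A makes that operator injective, and its
powers regularise every function of polynomial growth. -/

namespace SectCalc

open Filter Topology MeasureTheory Complex

/-! ### Residue theorem on a horizontal strip. -/

section Strip

variable {E : Type*} [NormedAddCommGroup E] [NormedSpace ℂ E]

/-- The integral of `Φ` over the horizontal line at height `y`. -/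
noncomputable def lineIntegral (Φ : ℂ → E) (y : ℝ) : E := ∫ t : ℝ, Φ (t + y * I)

theorem tendsto_arg_add_mul_I (k : ℝ) :
    Tendsto (fun T : ℝ => arg ((T : ℂ) + k * I)) atTop (𝓝 0) := by
  have h1 : Tendsto (fun T : ℝ => (1 : ℂ) + ((k / T : ℝ) : ℂ) * I) atTop (𝓝 1) := by
    have : Tendsto (fun T : ℝ => k / T) atTop (𝓝 0) := tendsto_const_nhds.div_atTop tendsto_id
    have h2 := ((continuous_ofReal.tendsto 0).comp this).mul_const I
    simpa using h2.const_add 1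
  have h3 := (continuousAt_arg (x := 1) (by simp)).tendsto.comp h1
  rw [arg_one] at h3
  refine h3.congr' ?_
  filter_upwards [eventually_gt_atTop 0] with T hT
  rw [Function.comp_apply, ← arg_real_mul _ hT]
  congr 1
  push_cast
  field_simp [ofReal_ne_zero.2 hT.ne']

/-- The principal logarithm is a primitive because the line misses the real axis. The two endpoints
have equal modulus, so only the arguments survive. -/
theorem integral_inv_add_mul_I {k : ℝ} (hk : k ≠ 0) (T : ℝ) :
    ∫ t in (-T)..T, ((t : ℂ) + k * I)⁻¹ =
      (arg (T + k * I) - arg (-T + k * I) : ℝ) * I := by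
  have hs (t : ℝ) : (t : ℂ) + k * I ∈ slitPlane := by
    rw [mem_slitPlane_iff]; right; simpa using hk
  have hd (t : ℝ) : HasDerivAt (fun t : ℝ => log ((t : ℂ) + k * I)) ((t : ℂ) + k * I)⁻¹ t := by
    have := ((hasDerivAt_id (t : ℂ)).add_const (k * I)).clog (hs t)
    simpa using this.comp_ofReal
  have hc : Continuous fun t : ℝ => ((t : ℂ) + k * I)⁻¹ :=
    Continuous.inv₀ (by fun_prop) fun t => slitPlane_ne_zero (hs t)
  rw [intervalIntegral.integral_eq_sub_of_hasDerivAt (fun t _ => hd t)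
    (hc.intervalIntegrable _ _)]
  have hn : ‖(T : ℂ) + k * I‖ = ‖-(T : ℂ) + k * I‖ := by
    rw [Complex.norm_def, Complex.norm_def]; simp [normSq_apply]
  simp only [log, ofReal_neg, hn]
  push_cast
  ring

/-- The left endpoint is minus the reflection of the right one, so its argument tends to −π. A line
below the pole thus carries half the residue; a line above it carries the opposite half. -/
theorem tendsto_integral_inv_of_neg {k : ℝ} (hk : k < 0) :
    Tendsto (fun T : ℝ => ∫ t in (-T)..T, ((t : ℂ) + k * I)⁻¹) atTop (𝓝 (Real.pi * I)) := by
  have h : Tendsto (fun T : ℝ => ((arg (T + k * I) -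
      (arg (T + (-k : ℝ) * I) - Real.pi) : ℝ) : ℂ) * I) atTop (𝓝 (Real.pi * I)) := by
    have := (tendsto_arg_add_mul_I k).sub ((tendsto_arg_add_mul_I (-k)).sub_const Real.pi)
    simpa using ((continuous_ofReal.tendsto _).comp this).mul_const I
  refine h.congr fun T => ?_
  rw [integral_inv_add_mul_I hk.ne, ← arg_neg_eq_arg_sub_pi_of_im_pos (by simpa using hk)]
  congr 4
  push_cast
  ring

theorem tendsto_integral_inv_of_pos {k : ℝ} (hk : 0 < k) :
    Tendsto (fun T : ℝ => ∫ t in (-T)..T, ((t : ℂ) + k * I)⁻¹) atTop (𝓝 (-(Real.pi * I))) := by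
  have h : Tendsto (fun T : ℝ => ((arg (T + k * I) -
      (arg (T + (-k : ℝ) * I) + Real.pi) : ℝ) : ℂ) * I) atTop (𝓝 (-(Real.pi * I))) := by
    have := (tendsto_arg_add_mul_I k).sub ((tendsto_arg_add_mul_I (-k)).add_const Real.pi)
    simpa using ((continuous_ofReal.tendsto _).comp this).mul_const I
  refine h.congr fun T => ?_
  rw [integral_inv_add_mul_I hk.ne', ← arg_neg_eq_arg_add_pi_of_im_neg (by simpa using hk)]
  congr 4
  push_cast
  ring

theorem integral_inv_sub_eq (u : ℂ) (y T : ℝ) :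
    ∫ t in (u.re - T)..(u.re + T), ((t : ℂ) + y * I - u)⁻¹ =
      ∫ t in (-T)..T, ((t : ℂ) + (y - u.im : ℝ) * I)⁻¹ := by
  have := intervalIntegral.integral_comp_add_right (a := -T) (b := T)
    (fun t : ℝ => ((t : ℂ) + y * I - u)⁻¹) u.re
  rw [show -T + u.re = u.re - T by ring, show T + u.re = u.re + T by ring] at this
  rw [← this]
  congr 1
  ext t
  congr 1
  apply Complex.ext <;> simp

theorem integrable_exp_neg_mul_abs {s : ℝ} (hs : 0 < s) :
    Integrable fun t : ℝ => Real.exp (-s * |t|) := by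
  rw [← integrableOn_univ, ← Iic_union_Ioi (a := 0)]
  refine IntegrableOn.union ?_ ?_
  · exact (integrableOn_exp_mul_Iic hs 0).congr_fun
      (fun t ht => by simp only [abs_of_nonpos (mem_Iic.1 ht)]; ring_nf) measurableSet_Iic
  · exact (exp_neg_integrableOn_Ioi 0 hs).congr_fun
      (fun t ht => by simp only [abs_of_pos (mem_Ioi.1 ht)]) measurableSet_Ioi

/-- Decay is demanded only away from `x₀`, the abscissa of a pole near which bounds degenerate;
continuity covers the remaining compact interval. -/
theorem integrable_line {φ : ℝ → E} (hφ : Continuous φ) {C s x₀ : ℝ} (hs : 0 < s)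
    (hb : ∀ t : ℝ, 1 ≤ |t - x₀| → ‖φ t‖ ≤ C * Real.exp (-s * |t|)) : Integrable φ := by
  obtain ⟨K, hK⟩ := (isCompact_Icc (a := x₀ - 1) (b := x₀ + 1)).exists_bound_of_continuousOn
    (f := fun t => Real.exp (s * |t|) • φ t) (by fun_prop)
  refine ((integrable_exp_neg_mul_abs hs).const_mul (max C K)).mono'
    hφ.aestronglyMeasurable (ae_of_all _ fun t => ?_)
  rcases le_or_gt 1 |t - x₀| with h | h
  · exact (hb t h).trans (by gcongr; exact le_max_left _ _)
  · rw [abs_lt] at h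
    have := hK t ⟨by linarith, by linarith⟩
    rw [norm_smul, Real.norm_of_nonneg (Real.exp_pos _).le] at this
    calc ‖φ t‖ = (Real.exp (s * |t|) * ‖φ t‖) * Real.exp (-s * |t|) := by
          rw [mul_right_comm, ← Real.exp_add]; simp
      _ ≤ _ := by gcongr; exact this.trans (le_max_right _ _)

theorem continuous_line {Φ : ℂ → E} {U : Set ℂ} (hΦ : DifferentiableOn ℂ Φ U) {y : ℝ}
    (hy : ∀ t : ℝ, (t + y * I : ℂ) ∈ U) : Continuous fun t : ℝ => Φ (t + y * I) := by
  rw [← continuousOn_univ]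
  exact hΦ.continuousOn.comp (by fun_prop) fun t _ => hy t

/-- The residue theorem on a horizontal strip, for a function with one simple pole `u`. -/
theorem lineIntegral_sub_lineIntegral [CompleteSpace E] {Φ G : ℂ → E} {U : Set ℂ} {a b C s : ℝ}
    {u : ℂ} (hU : IsOpen U) (hs : 0 < s) (ha : a < u.im) (hb : u.im < b)
    (hstrip : ∀ v : ℂ, a ≤ v.im → v.im ≤ b → v ∈ U) (hG : DifferentiableOn ℂ G U)
    (hΦ : ∀ v : ℂ, a ≤ v.im → v.im ≤ b → v ≠ u → Φ v = (v - u)⁻¹ • G v)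
    (hbd : ∀ v : ℂ, a ≤ v.im → v.im ≤ b → 1 ≤ |v.re - u.re| →
      ‖Φ v‖ ≤ C * Real.exp (-s * |v.re|)) :
    lineIntegral Φ a - lineIntegral Φ b = (2 * Real.pi * I) • G u := by
  have hab : a ≤ b := (ha.trans hb).le
  have huU : U ∈ 𝓝 u := hU.mem_nhds (hstrip u ha.le hb.le)
  -- `dslope G u` is Φ with its polar part removed, hence holomorphic across u: its rectangle
  -- integrals vanish, and only the explicit term (v − u)⁻¹ G(u) has to be integrated.
  have hD : DifferentiableOn ℂ (dslope G u) U := (differentiableOn_dslope huU).2 hG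
  have hΦD (v : ℂ) (h1 : a ≤ v.im) (h2 : v.im ≤ b) (h3 : v ≠ u) :
      dslope G u v = Φ v - (v - u)⁻¹ • G u := by
    rw [dslope_of_ne _ h3, slope_def_module, hΦ v h1 h2 h3, smul_sub]
  have hline {y : ℝ} (hy : y ≠ u.im) (t : ℝ) : (t + y * I : ℂ) ≠ u := fun h => hy (by
    rw [← h]; simp)
  -- the integral along a horizontal line bounding the strip
  have hhor (y : ℝ) (hay : a ≤ y) (hyb : y ≤ b) (hy : y ≠ u.im) (c : ℂ)
      (hc : Tendsto (fun T : ℝ => ∫ t in (-T)..T, ((t : ℂ) + (y - u.im : ℝ) * I)⁻¹)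
        atTop (𝓝 c)) :
      Tendsto (fun T : ℝ => ∫ t in (u.re - T)..(u.re + T), dslope G u (t + y * I)) atTop
        (𝓝 (lineIntegral Φ y - c • G u)) := by
    have hci : Continuous fun t : ℝ => ((t : ℂ) + y * I - u)⁻¹ :=
      Continuous.inv₀ (by fun_prop) fun t => sub_ne_zero.2 (hline hy t)
    have hcΦ : Continuous fun t : ℝ => Φ (t + y * I) := by
      have h : Continuous fun t : ℝ => ((t : ℂ) + y * I - u)⁻¹ • G (t + y * I) :=
        hci.smul (continuous_line hG fun t => hstrip _ (by simpa) (by simpa))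
      refine h.congr fun t => (hΦ _ (by simpa) (by simpa) (hline hy t)).symm
    have hi : Integrable fun t : ℝ => Φ (t + y * I) :=
      integrable_line hcΦ hs (x₀ := u.re) (C := C) fun t ht => by
        simpa using hbd (t + y * I) (by simpa) (by simpa) (by simpa)
    -- The intervals are symmetric about `u.re` because (v − u)⁻¹ is not integrable on the line and
    -- has only a principal value.
    have h1 := (intervalIntegral_tendsto_integral hi
      (tendsto_atBot_add_const_left atTop u.re tendsto_neg_atTop_atBot)
      (tendsto_atTop_add_const_left atTop u.re tendsto_id)).sub (hc.smul_const (G u))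
    refine h1.congr fun T => ?_
    have hcG : Continuous fun t : ℝ => ((t : ℂ) + y * I - u)⁻¹ • G u := hci.smul continuous_const
    rw [← integral_inv_sub_eq, ← intervalIntegral.integral_smul_const, id, ← sub_eq_add_neg,
      ← intervalIntegral.integral_sub (hcΦ.intervalIntegrable _ _)
        (hcG.intervalIntegrable _ _)]
    refine intervalIntegral.integral_congr fun t _ => ?_
    exact (hΦD _ (by simpa) (by simpa) (hline hy t)).symm
  -- the integral along the vertical sides
  have hver (x : ℝ → ℝ) (hx : ∀ T, |x T - u.re| = |T|) :
      Tendsto (fun T : ℝ => ∫ y in a..b, dslope G u (x T + y * I)) atTop (𝓝 0) := by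
    have hlim : Tendsto (fun T : ℝ => (|C| * Real.exp (-s * (T - |u.re|)) + T⁻¹ * ‖G u‖) *
        |b - a|) atTop (𝓝 0) := by
      have h1 : Tendsto (fun T : ℝ => Real.exp (-s * (T - |u.re|))) atTop (𝓝 0) := by
        refine Real.tendsto_exp_atBot.comp ?_
        exact Tendsto.const_mul_atTop_of_neg (by linarith)
          (tendsto_atTop_add_const_right _ _ tendsto_id)
      simpa using ((h1.const_mul |C|).add (tendsto_inv_atTop_zero.mul_const ‖G u‖)).mul_const
        |b - a|
    refine squeeze_zero_norm' ?_ hlim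
    filter_upwards [eventually_ge_atTop 1] with T hT
    refine intervalIntegral.norm_integral_le_of_norm_le_const fun y hy => ?_
    rw [uIoc_of_le hab] at hy
    have hxT : |x T - u.re| = T := by rw [hx, abs_of_pos (by linarith)]
    have hne : (x T + y * I : ℂ) ≠ u := fun h => by
      have : x T = u.re := by rw [← h]; simp
      rw [this] at hxT
      simp at hxT
      linarith
    rw [hΦD _ (by simpa using hy.1.le) (by simpa using hy.2) hne]
    refine (norm_sub_le _ _).trans (add_le_add ?_ ?_)
    · refine (hbd _ (by simpa using hy.1.le) (by simpa using hy.2)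
        (by simpa [hxT] using hT)).trans ?_
      have : T - |u.re| ≤ |x T| := by
        linarith [abs_sub (x T) u.re]
      refine mul_le_mul (le_abs_self C) (Real.exp_le_exp.2 ?_) (Real.exp_pos _).le (abs_nonneg C)
      simp only [add_re, ofReal_re, mul_re, I_re, mul_zero, ofReal_im, I_im, mul_one, sub_self,
        add_zero]
      nlinarith
    · rw [norm_smul, norm_inv]
      gcongr
      calc T = |(x T + y * I - u : ℂ).re| := by simp [hxT]
        _ ≤ _ := abs_re_le_norm _
  have hrect (T : ℝ) := integral_boundary_rect_eq_zero_of_differentiableOn (dslope G u)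
    ⟨u.re - T, a⟩ ⟨u.re + T, b⟩ (hD.mono fun v hv => by
      rw [mem_reProdIm, uIcc_of_le hab] at hv
      exact hstrip v hv.2.1 hv.2.2)
  have hA := hhor a le_rfl hab ha.ne _ (tendsto_integral_inv_of_neg (sub_neg.2 ha))
  have hB := hhor b hab le_rfl hb.ne' _ (tendsto_integral_inv_of_pos (sub_pos.2 hb))
  have hR := (hver (fun T => u.re + T) fun T => by simp).const_smul I
  have hL := (hver (fun T => u.re - T) fun T => by simp).const_smul I
  have h0 := tendsto_nhds_unique (((hA.sub hB).add hR).sub hL)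
    (tendsto_const_nhds.congr fun T => (hrect T).symm)
  rw [smul_zero, add_zero, sub_zero, neg_smul, sub_neg_eq_add, sub_eq_zero] at h0
  have : lineIntegral Φ a = lineIntegral Φ b + (Real.pi * I) • G u + (Real.pi * I) • G u := by
    rw [← h0, sub_add_cancel]
  rw [this, mul_assoc, two_mul, add_smul]
  abel

/-- Cauchy's theorem on a horizontal strip. -/
theorem lineIntegral_eq_lineIntegral [CompleteSpace E] {Φ : ℂ → E} {U : Set ℂ} {a b C s x₀ : ℝ}
    (hU : IsOpen U) (hs : 0 < s) (hab : a < b)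
    (hstrip : ∀ v : ℂ, a ≤ v.im → v.im ≤ b → v ∈ U) (hΦ : DifferentiableOn ℂ Φ U)
    (hbd : ∀ v : ℂ, a ≤ v.im → v.im ≤ b → 1 ≤ |v.re - x₀| → ‖Φ v‖ ≤ C * Real.exp (-s * |v.re|)) :
    lineIntegral Φ a = lineIntegral Φ b := by
  -- A fictitious pole in the middle of the strip, with residue zero.
  have h := lineIntegral_sub_lineIntegral (Φ := Φ) (u := ⟨x₀, (a + b) / 2⟩)
    (G := fun v => (v - ⟨x₀, (a + b) / 2⟩) • Φ v) hU hs (by simp; linarith) (by simp; linarith)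
    hstrip ((by fun_prop : DifferentiableOn ℂ (fun v : ℂ => v - ⟨x₀, (a + b) / 2⟩) U).smul hΦ)
    (fun v _ _ h => by rw [smul_smul, inv_mul_cancel₀ (sub_ne_zero.2 h), one_smul])
    hbd
  simpa [sub_eq_zero] using h

end Strip

/-! ### The resolvent of a sectorial operator. -/

section Resolvent

variable {X : Type*} [NormedAddCommGroup X] [NormedSpace ℂ X]

/-- Replacing arg by its cosine makes openness visible, although arg jumps on the negative axis
inside this set. -/
theorem compl_closedSector_eq {ω : ℝ} (h0 : 0 < ω) (hπ : ω < Real.pi) :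
    (closedSector ω)ᶜ = {z : ℂ | z.re < Real.cos ω * ‖z‖} := by
  ext z
  rcases eq_or_ne z 0 with rfl | hz
  · simp [closedSector, h0.le]
  · have hn : 0 < ‖z‖ := norm_pos_iff.2 hz
    have hre : z.re = Real.cos |z.arg| * ‖z‖ := by
      rw [Real.cos_abs, cos_arg hz]; field_simp
    simp only [mem_compl_iff, closedSector, mem_ofPred_eq, not_le]
    rw [hre, mul_lt_mul_iff_left₀ hn]
    exact (Real.strictAntiOn_cos.lt_iff_gt ⟨abs_nonneg _, abs_arg_le_pi z⟩ ⟨h0.le, hπ.le⟩).symm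

theorem isOpen_compl_closedSector {ω : ℝ} (h0 : 0 < ω) (hπ : ω < Real.pi) :
    IsOpen (closedSector ω)ᶜ := by
  rw [compl_closedSector_eq h0 hπ]
  exact isOpen_lt (by fun_prop) (by fun_prop)

/-- Heights beyond π are allowed so that a contour can be moved across the negative axis. -/
theorem exp_mem_compl_closedSector {ω : ℝ} (h0 : 0 < ω) (hπ : ω < Real.pi) {v : ℂ}
    (h1 : ω < |v.im|) (h2 : |v.im| < 2 * Real.pi - ω) : exp v ∈ (closedSector ω)ᶜ := by
  rw [compl_closedSector_eq h0 hπ]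
  have : Real.cos v.im < Real.cos ω := by
    rw [← Real.cos_abs]
    rcases le_total |v.im| Real.pi with h | h
    · exact Real.cos_lt_cos_of_nonneg_of_le_pi h0.le h h1
    · rw [← Real.cos_two_pi_sub]
      exact Real.cos_lt_cos_of_nonneg_of_le_pi h0.le (by linarith) (by linarith)
  rw [mem_ofPred_eq, exp_re, norm_exp, mul_comm]
  exact mul_lt_mul_of_pos_right this (Real.exp_pos _)

variable {A : X →ₗ.[ℂ] X} {ω : ℝ}

theorem IsSect.isResolvent (hA : IsSect ω A) {z : ℂ} (hz : z ∉ closedSector ω) :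
    IsResolvent A z (res A z) := by
  have h : ∃ R, IsResolvent A z R := by
    by_contra h
    exact hz (hA.spec_subset h)
  rw [res, dif_pos h]
  exact h.choose_spec

theorem IsResolvent.sub_eq {z w : ℂ} {R S : X →L[ℂ] X} (hR : IsResolvent A z R)
    (hS : IsResolvent A w S) : R - S = (w - z) • (R * S) := by
  ext x
  obtain ⟨h, hx⟩ := hS.1 x
  have h1 := hR.2 ⟨S x, h⟩
  have h2 : z • S x - A ⟨S x, h⟩ = (z - w) • S x + x := by
    rw [sub_eq_iff_eq_add'] at hx
    rw [sub_smul, hx]; abel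
  rw [h2, map_add, map_smul] at h1
  change R x - S x = (w - z) • R (S x)
  rw [← neg_sub z w, neg_smul, eq_sub_iff_add_eq'.2 h1]
  abel

/-- `z (z - A)⁻¹` in the logarithmic coordinate `z = exp v`. -/
noncomputable def logRes (A : X →ₗ.[ℂ] X) (v : ℂ) : X →L[ℂ] X := exp v • res A (exp v)

theorem IsSect.res_sub_res (hA : IsSect ω A) {z w : ℂ} (hz : z ∉ closedSector ω)
    (hw : w ∉ closedSector ω) : res A z - res A w = (w - z) • (res A z * res A w) :=
  (hA.isResolvent hz).sub_eq (hA.isResolvent hw)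

/-- The sectorial bound is locally uniform away from 0, so the resolvent identity gives continuity;
it then turns the difference quotient into −R(w)R(z), which converges. -/
theorem IsSect.differentiableOn_res (hA : IsSect ω A) (h0 : 0 < ω) (hπ : ω < Real.pi) :
    DifferentiableOn ℂ (res A) (closedSector ω)ᶜ := by
  obtain ⟨M, hM⟩ := hA.bound
  intro z hz
  have hz0 : z ≠ 0 := fun h => hz (by simp [h, closedSector, h0.le])
  have hn : 0 < ‖z‖ := norm_pos_iff.2 hz0
  have hU : ∀ᶠ w in 𝓝 z, w ∈ (closedSector ω)ᶜ := (isOpen_compl_closedSector h0 hπ).mem_nhds hz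
  have hev : ∀ᶠ w in 𝓝 z, w ∈ (closedSector ω)ᶜ ∧ ‖z‖ / 2 < ‖w‖ :=
    hU.and
      ((continuous_norm.tendsto z).eventually (lt_mem_nhds (by linarith)))
  have hM0 : 0 ≤ M := (norm_nonneg _).trans (hM z hz)
  have hcont : ContinuousAt (res A) z := by
    rw [ContinuousAt, tendsto_iff_norm_sub_tendsto_zero]
    have hlim : Tendsto (fun w => ‖z - w‖ * (M / (‖z‖ / 2) * ‖res A z‖)) (𝓝 z) (𝓝 0) := by
      have : Tendsto (fun w => ‖z - w‖) (𝓝 z) (𝓝 ‖z - z‖) :=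
        (continuous_const.sub continuous_id).norm.tendsto z
      simpa using this.mul_const (M / (‖z‖ / 2) * ‖res A z‖)
    refine squeeze_zero' (Eventually.of_forall fun _ => norm_nonneg _) ?_ hlim
    filter_upwards [hev] with w hw
    rw [hA.res_sub_res hw.1 hz, norm_smul]
    gcongr
    refine (norm_mul_le _ _).trans ?_
    gcongr
    have := hM w hw.1
    rw [norm_smul] at this
    rw [le_div_iff₀ (by positivity), mul_comm]
    exact (mul_le_mul_of_nonneg_right hw.2.le (norm_nonneg _)).trans this
  have hderiv : HasDerivAt (res A) (-(res A z * res A z)) z := by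
    rw [hasDerivAt_iff_tendsto_slope]
    have h1 : Tendsto (fun w => -(res A w * res A z)) (𝓝[≠] z) (𝓝 (-(res A z * res A z))) :=
      ((hcont.mul_const _).neg).tendsto.mono_left nhdsWithin_le_nhds
    refine h1.congr' ?_
    filter_upwards [nhdsWithin_le_nhds hev, self_mem_nhdsWithin] with w hw hne
    have hne' : w - z ≠ 0 := sub_ne_zero.2 hne
    rw [slope_def_module, hA.res_sub_res hw.1 hz, smul_smul, ← neg_sub w z, mul_neg,
      inv_mul_cancel₀ hne', neg_one_smul]
  exact hderiv.differentiableAt.differentiableWithinAt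

theorem isOpen_logRes_domain (h0 : 0 < ω) (hπ : ω < Real.pi) :
    IsOpen (exp ⁻¹' (closedSector ω)ᶜ) :=
  (isOpen_compl_closedSector h0 hπ).preimage continuous_exp

theorem IsSect.differentiableOn_logRes (hA : IsSect ω A) (h0 : 0 < ω) (hπ : ω < Real.pi) :
    DifferentiableOn ℂ (logRes A) (exp ⁻¹' (closedSector ω)ᶜ) :=
  differentiable_exp.differentiableOn.smul
    ((hA.differentiableOn_res h0 hπ).comp differentiable_exp.differentiableOn fun _ h => h)

theorem IsSect.exists_norm_logRes_le (hA : IsSect ω A) :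
    ∃ M : ℝ, 0 ≤ M ∧ ∀ v, exp v ∈ (closedSector ω)ᶜ → ‖logRes A v‖ ≤ M := by
  obtain ⟨M, hM⟩ := hA.bound
  exact ⟨max M 0, le_max_right _ _, fun v hv => (hM _ hv).trans (le_max_left _ _)⟩

/-- The resolvent identity, arranged so that the coefficients are, up to sign, scalar Cauchy kernels
in each of the two variables. -/
theorem IsSect.logRes_mul_logRes (hA : IsSect ω A) {v w : ℂ} (hv : exp v ∈ (closedSector ω)ᶜ)
    (hw : exp w ∈ (closedSector ω)ᶜ) (hne : exp w ≠ exp v) :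
    logRes A v * logRes A w = (exp w / (exp w - exp v)) • logRes A v -
      (exp v / (exp w - exp v)) • logRes A w := by
  have h := hA.res_sub_res hv hw
  have hd : exp w - exp v ≠ 0 := sub_ne_zero.2 hne
  have h' : res A (exp v) * res A (exp w) =
      (exp w - exp v)⁻¹ • (res A (exp v) - res A (exp w)) := by
    rw [h, smul_smul, inv_mul_cancel₀ hd, one_smul]
  simp only [logRes, smul_mul_smul_comm, h', smul_sub, smul_smul]
  congr 2 <;> ring

end Resolvent

/-! ### The Cauchy integral in logarithmic coordinates. -/

section Primary

theorem exp_mem_sector {ψ : ℝ} (hψ : ψ ≤ Real.pi) {v : ℂ} (hv : |v.im| < ψ) :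
    exp v ∈ sector ψ := by
  obtain ⟨h1, h2⟩ := abs_lt.1 hv
  refine ⟨exp_ne_zero v, ?_⟩
  rw [← log_im, log_exp (by linarith) (by linarith)]
  exact hv

theorem isOpen_abs_im_lt (ψ : ℝ) : IsOpen {v : ℂ | |v.im| < ψ} :=
  isOpen_lt (by fun_prop) continuous_const

theorem differentiableOn_comp_exp {f : ℂ → ℂ} {ψ : ℝ} (hψ : ψ ≤ Real.pi)
    (hf : DifferentiableOn ℂ f (sector ψ)) :
    DifferentiableOn ℂ (fun v => f (exp v)) {v : ℂ | |v.im| < ψ} :=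
  hf.comp differentiable_exp.differentiableOn fun _ h => exp_mem_sector hψ h

theorem MemH0.exists_norm_exp_le {f : ℂ → ℂ} {ψ : ℝ} (hψ : ψ ≤ Real.pi) (hf : MemH0 ψ f) :
    ∃ C > (0 : ℝ), ∃ s > (0 : ℝ), ∀ v : ℂ, |v.im| < ψ →
      ‖f (exp v)‖ ≤ C * Real.exp (-s * |v.re|) := by
  obtain ⟨-, C, hC, s, hs, h⟩ := hf
  refine ⟨C, hC, s, hs, fun v hv => (h _ (exp_mem_sector hψ hv)).trans ?_⟩
  gcongr
  rw [norm_exp, ← Real.exp_mul, ← Real.exp_mul]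
  rcases abs_cases v.re with ⟨h, -⟩ | ⟨h, -⟩ <;> rw [h]
  · exact (min_le_right _ _).trans (Real.exp_le_exp.2 (by linarith))
  · exact (min_le_left _ _).trans (Real.exp_le_exp.2 (by linarith))

variable {X : Type*} [NormedAddCommGroup X] [NormedSpace ℂ X] {A : X →ₗ.[ℂ] X} {ω : ℝ}

/-- The integrand of the Cauchy integral in the logarithmic coordinate. -/
noncomputable def integrand (A : X →ₗ.[ℂ] X) (f : ℂ → ℂ) (v : ℂ) : X →L[ℂ] X :=
  f (exp v) • logRes A v

/-- Substitute r = exp t: the Jacobian and the direction of the ray combine to the factor z that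
turns (z − A)⁻¹ into `logRes`. -/
theorem integral_ray_eq (A : X →ₗ.[ℂ] X) (f : ℂ → ℂ) (α : ℝ) :
    ∫ r in Ioi (0 : ℝ), (f (r * exp (α * I)) * exp (α * I)) • res A (r * exp (α * I)) =
      lineIntegral (integrand A f) α := by
  rw [← Real.range_exp, ← image_univ,
    integral_image_eq_integral_abs_deriv_smul MeasurableSet.univ
      (fun x _ => (Real.hasDerivAt_exp x).hasDerivWithinAt) Real.exp_injective.injOn,
    Measure.restrict_univ, lineIntegral]
  congr 1
  ext1 t
  rw [abs_of_pos (Real.exp_pos t), integrand, logRes, exp_add, ofReal_exp, ← coe_smul, smul_smul,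
    smul_smul, ofReal_exp]
  congr 1
  ring

theorem cauchy_eq (A : X →ₗ.[ℂ] X) (θ : ℝ) (f : ℂ → ℂ) :
    cauchy A θ f = (2 * Real.pi * I)⁻¹ •
      (lineIntegral (integrand A f) (-θ) - lineIntegral (integrand A f) θ) := by
  rw [← integral_ray_eq, ← integral_ray_eq]
  rfl

theorem cauchy_congr {f g : ℂ → ℂ} {θ ψ : ℝ} (hθ : 0 < θ) (hθψ : θ < ψ) (hψ : ψ ≤ Real.pi)
    (h : EqOn f g (sector ψ)) : cauchy A θ f = cauchy A θ g := by
  have (y : ℝ) (hy : |y| < ψ) : lineIntegral (integrand A f) y =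
      lineIntegral (integrand A g) y := by
    unfold lineIntegral integrand
    congr 1
    ext1 t
    rw [h (exp_mem_sector hψ (by simpa))]
  rw [cauchy_eq, cauchy_eq, this θ (by rwa [abs_of_pos hθ]),
    this (-θ) (by rwa [abs_neg, abs_of_pos hθ])]

theorem differentiableOn_integrand (hA : IsSect ω A) (h0 : 0 < ω) {ψ : ℝ} (hωψ : ω < ψ)
    (hψ : ψ ≤ Real.pi) {f : ℂ → ℂ} (hf : DifferentiableOn ℂ f (sector ψ)) :
    DifferentiableOn ℂ (integrand A f) ({v : ℂ | |v.im| < ψ} ∩ exp ⁻¹' (closedSector ω)ᶜ) :=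
  ((differentiableOn_comp_exp hψ hf).mono inter_subset_left).smul
    ((hA.differentiableOn_logRes h0 (hωψ.trans_le hψ)).mono inter_subset_right)

theorem abs_im_mem {ψ : ℝ} (h0 : 0 < ω) (hωψ : ω < ψ) (hψ : ψ ≤ Real.pi) {v : ℂ}
    (h1 : ω < |v.im|) (h2 : |v.im| < ψ) :
    v ∈ {v : ℂ | |v.im| < ψ} ∩ exp ⁻¹' (closedSector ω)ᶜ :=
  ⟨h2, exp_mem_compl_closedSector h0 (hωψ.trans_le hψ) h1 (by linarith)⟩

theorem MemH0.exists_norm_integrand_le (hA : IsSect ω A) {ψ : ℝ}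
    (hψ : ψ ≤ Real.pi) {f : ℂ → ℂ} (hf : MemH0 ψ f) :
    ∃ C, ∃ s > (0 : ℝ), ∀ v ∈ {v : ℂ | |v.im| < ψ} ∩ exp ⁻¹' (closedSector ω)ᶜ,
      ‖integrand A f v‖ ≤ C * Real.exp (-s * |v.re|) := by
  obtain ⟨C, hC, s, hs, h⟩ := hf.exists_norm_exp_le hψ
  obtain ⟨M, hM, hM'⟩ := hA.exists_norm_logRes_le
  refine ⟨C * M, s, hs, fun v hv => ?_⟩
  rw [integrand, norm_smul, mul_right_comm]
  exact mul_le_mul (h v hv.1) (hM' v hv.2) (norm_nonneg _) (by positivity)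

theorem MemH0.integrable_integrand (hA : IsSect ω A) (h0 : 0 < ω) {ψ : ℝ} (hωψ : ω < ψ)
    (hψ : ψ ≤ Real.pi) {f : ℂ → ℂ} (hf : MemH0 ψ f) {y : ℝ} (h1 : ω < |y|) (h2 : |y| < ψ) :
    Integrable fun t : ℝ => integrand A f (t + y * I) := by
  obtain ⟨C, s, hs, h⟩ := hf.exists_norm_integrand_le hA hψ
  have hmem (t : ℝ) := abs_im_mem (v := t + y * I) h0 hωψ hψ (by simpa) (by simpa)
  exact integrable_line (continuous_line (differentiableOn_integrand hA h0 hωψ hψ hf.1) hmem) hs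
    (x₀ := 0) fun t _ => by simpa using h _ (hmem t)

theorem lineIntegral_integrand_eq [CompleteSpace X] (hA : IsSect ω A) (h0 : 0 < ω) {ψ : ℝ}
    (hωψ : ω < ψ) (hψ : ψ ≤ Real.pi) {f : ℂ → ℂ} (hf : MemH0 ψ f) {a b : ℝ} (hab : a < b)
    (h : ∀ y, a ≤ y → y ≤ b → ω < |y| ∧ |y| < ψ) :
    lineIntegral (integrand A f) a = lineIntegral (integrand A f) b := by
  obtain ⟨C, s, hs, hC⟩ := hf.exists_norm_integrand_le hA hψ
  have hmem (v : ℂ) (h1 : a ≤ v.im) (h2 : v.im ≤ b) :=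
    abs_im_mem h0 hωψ hψ (h v.im h1 h2).1 (h v.im h1 h2).2
  exact lineIntegral_eq_lineIntegral (x₀ := 0)
    ((isOpen_abs_im_lt ψ).inter (isOpen_logRes_domain h0 (hωψ.trans_le hψ))) hs hab hmem
    (differentiableOn_integrand hA h0 hωψ hψ hf.1) fun v h1 h2 _ => hC v (hmem v h1 h2)

/-- The Cauchy integral does not depend on the angle of the contour. -/
theorem cauchy_eq_cauchy [CompleteSpace X] (hA : IsSect ω A) (h0 : 0 < ω) {ψ θ θ' : ℝ}
    (hψ : ψ ≤ Real.pi) {f : ℂ → ℂ} (hf : MemH0 ψ f) (h1 : ω < θ) (h2 : θ < ψ) (h1' : ω < θ')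
    (h2' : θ' < ψ) : cauchy A θ f = cauchy A θ' f := by
  wlog h : θ < θ' generalizing θ θ'
  · rcases (not_lt.1 h).eq_or_lt with h | h
    · rw [h]
    · exact (this h1' h2' h1 h2 h).symm
  rw [cauchy_eq, cauchy_eq,
    lineIntegral_integrand_eq hA h0 (h1.trans h2) hψ hf h fun y hy hy' => by
      rw [abs_of_pos (by linarith)]; constructor <;> linarith,
    lineIntegral_integrand_eq hA h0 (h1.trans h2) hψ hf (neg_lt_neg h) fun y hy hy' => by
      rw [abs_of_neg (by linarith)]; constructor <;> linarith]

end Primary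

/-! ### Cauchy's formula for scalar functions on a sector. -/

section Kernel

/-- The Cauchy kernel in logarithmic coordinates. -/
noncomputable def kernel (u w : ℂ) : ℂ := exp w / (exp w - exp u)

/-- With c the cosine of the angle between the two numbers, the right side exceeds the left by (1 +
c)/2 times the squared difference of their moduli. -/
theorem mul_sq_le_sq_norm_exp_sub_exp (u w : ℂ) :
    (1 - Real.cos (w.im - u.im)) / 2 * (‖exp w‖ + ‖exp u‖) ^ 2 ≤ ‖exp w - exp u‖ ^ 2 := by
  rw [Complex.sq_norm (exp w - exp u), normSq_apply, norm_exp, norm_exp, sub_re, sub_im, exp_re,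
    exp_re, exp_im, exp_im, Real.cos_sub]
  have h1 := Real.sin_sq_add_cos_sq w.im
  have h2 := Real.sin_sq_add_cos_sq u.im
  have h3 := Real.neg_one_le_cos (w.im - u.im)
  rw [Real.cos_sub] at h3
  have h4 := mul_nonneg (by linarith : 0 ≤ 1 + (Real.cos w.im * Real.cos u.im +
    Real.sin w.im * Real.sin u.im)) (sq_nonneg (Real.exp w.re - Real.exp u.re))
  linear_combination h4 / 2 - Real.exp w.re ^ 2 * h1 - Real.exp u.re ^ 2 * h2

theorem exists_norm_kernel_le {c : ℝ} (hc : c < 1) :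
    ∃ K : ℝ, 0 < K ∧ ∀ u w : ℂ, Real.cos (w.im - u.im) ≤ c →
      (‖exp w‖ + ‖exp u‖) ≤ K * ‖exp w - exp u‖ := by
  have hpos : 0 < √((1 - c) / 2) := Real.sqrt_pos.2 (by linarith)
  refine ⟨(√((1 - c) / 2))⁻¹, inv_pos.2 hpos, fun u w h => ?_⟩
  rw [inv_mul_eq_div, le_div_iff₀ hpos]
  refine abs_le_of_sq_le_sq' ?_ (norm_nonneg _) |>.2
  rw [mul_pow, Real.sq_sqrt (by linarith), mul_comm]
  refine le_trans ?_ (mul_sq_le_sq_norm_exp_sub_exp u w)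
  gcongr

/-- The moduli of exp w and exp u differ by a factor of at least e, so no condition on the imaginary
parts is needed. -/
theorem norm_kernel_le_of_one_le {u w : ℂ} (h : 1 ≤ |w.re - u.re|) :
    ‖kernel u w‖ ≤ (1 - Real.exp (-1))⁻¹ := by
  have he : 0 < 1 - Real.exp (-1) := by
    have := Real.exp_lt_one_iff.2 (show (-1 : ℝ) < 0 by norm_num); linarith
  have hkey : (1 - Real.exp (-1)) * ‖exp w‖ ≤ ‖exp w - exp u‖ := by
    rcases le_abs.1 h with h | h
    · refine le_trans ?_ (norm_sub_norm_le _ _)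
      have : ‖exp u‖ ≤ Real.exp (-1) * ‖exp w‖ := by
        rw [norm_exp, norm_exp, ← Real.exp_add]; exact Real.exp_le_exp.2 (by linarith)
      linarith
    · rw [norm_sub_rev]
      refine le_trans ?_ (norm_sub_norm_le _ _)
      have h1 : ‖exp w‖ ≤ Real.exp (-1) * ‖exp u‖ := by
        rw [norm_exp, norm_exp, ← Real.exp_add]; exact Real.exp_le_exp.2 (by linarith)
      have h2 : ‖exp w‖ ≤ ‖exp u‖ := by
        rw [norm_exp, norm_exp]; exact Real.exp_le_exp.2 (by linarith)
      nlinarith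
  have hpos : 0 < ‖exp w - exp u‖ :=
    lt_of_lt_of_le (mul_pos he (norm_pos_iff.2 (exp_ne_zero w))) hkey
  rw [kernel, norm_div, div_le_iff₀ hpos, inv_mul_eq_div, le_div_iff₀ he, mul_comm]
  exact hkey

theorem exp_ne_exp {u w : ℂ} (h1 : |u.im| < Real.pi) (h2 : |w.im| < Real.pi) (hne : w ≠ u) :
    exp w ≠ exp u := fun h => hne <|
  exp_inj_of_neg_pi_lt_of_le_pi (abs_lt.1 h2).1 (abs_lt.1 h2).2.le (abs_lt.1 h1).1
    (abs_lt.1 h1).2.le h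

theorem dslope_exp_ne_zero {u w : ℂ} (h : w ≠ u → exp w ≠ exp u) : dslope exp u w ≠ 0 := by
  rcases eq_or_ne w u with rfl | hne
  · rw [dslope_same, Complex.deriv_exp]
    exact exp_ne_zero w
  · rw [dslope_of_ne _ hne, slope_def_field]
    exact div_ne_zero (sub_ne_zero.2 (h hne)) (sub_ne_zero.2 hne)

theorem differentiable_dslope_exp (u : ℂ) : Differentiable ℂ (dslope exp u) := by
  rw [← differentiableOn_univ, differentiableOn_dslope univ_mem]
  exact differentiable_exp.differentiableOn

/-- Exhibits the simple pole at u: the second factor equals 1 there, so the residue is 1. -/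
theorem kernel_eq {u w : ℂ} (hne : w ≠ u) :
    kernel u w = (w - u)⁻¹ * (exp w / dslope exp u w) := by
  have h := sub_ne_zero.2 hne
  rw [kernel, dslope_of_ne _ hne, slope_def_field]
  field_simp

theorem kernel_swap (u w : ℂ) : kernel u w = -(exp w / (exp u - exp w)) := by
  rw [kernel, ← div_neg, neg_sub]

/-- The (unnormalised) scalar Cauchy integral over one line. -/
noncomputable def scalarCauchy (f : ℂ → ℂ) (y : ℝ) (u : ℂ) : ℂ :=
  lineIntegral (fun w => f (exp w) * kernel u w) y

theorem scalarCauchy_bound {f : ℂ → ℂ} {C s : ℝ} {ψ : ℝ}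
    (h : ∀ v : ℂ, |v.im| < ψ → ‖f (exp v)‖ ≤ C * Real.exp (-s * |v.re|)) {u w : ℂ}
    (hw : |w.im| < ψ) (hre : 1 ≤ |w.re - u.re|) :
    ‖f (exp w) * kernel u w‖ ≤ C * (1 - Real.exp (-1))⁻¹ * Real.exp (-s * |w.re|) := by
  rw [norm_mul, mul_right_comm]
  exact mul_le_mul (h w hw) (norm_kernel_le_of_one_le hre) (norm_nonneg _)
    ((norm_nonneg _).trans (h w hw))

/-- Cauchy's formula on a sector. -/
theorem scalarCauchy_sub_of_lt {ψ θ : ℝ} (hψ : ψ ≤ Real.pi) (hθψ : θ < ψ) {f : ℂ → ℂ}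
    (hf : MemH0 ψ f) {u : ℂ} (hu : |u.im| < θ) :
    scalarCauchy f (-θ) u - scalarCauchy f θ u = 2 * Real.pi * I * f (exp u) := by
  obtain ⟨C, hC, s, hs, h⟩ := hf.exists_norm_exp_le hψ
  have huπ : |u.im| < Real.pi := by linarith
  have hne {w : ℂ} (hw : |w.im| < ψ) : dslope exp u w ≠ 0 :=
    dslope_exp_ne_zero fun hne => exp_ne_exp huπ (hw.trans_le hψ) hne
  have hstrip (v : ℂ) (h1 : -θ ≤ v.im) (h2 : v.im ≤ θ) : |v.im| < ψ :=
    (abs_le.2 ⟨h1, h2⟩).trans_lt hθψ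
  have hG : DifferentiableOn ℂ (fun w => f (exp w) * (exp w / dslope exp u w))
      {w : ℂ | |w.im| < ψ} :=
    (differentiableOn_comp_exp hψ hf.1).mul (differentiable_exp.differentiableOn.div
      (differentiable_dslope_exp u).differentiableOn fun w hw => hne hw)
  have := lineIntegral_sub_lineIntegral (Φ := fun w => f (exp w) * kernel u w)
    (isOpen_abs_im_lt ψ) hs (abs_lt.1 hu).1 (abs_lt.1 hu).2 hstrip hG
    (fun v _ _ hv => by rw [kernel_eq hv, smul_eq_mul, mul_left_comm])
    (fun v h1 h2 h3 => scalarCauchy_bound h (hstrip v h1 h2) h3)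
  rw [scalarCauchy, scalarCauchy, this, dslope_same, Complex.deriv_exp, div_self (exp_ne_zero u),
    mul_one, smul_eq_mul]

/-- Cauchy's theorem on a sector. -/
theorem scalarCauchy_sub_of_gt {ψ θ : ℝ} (hψ : ψ ≤ Real.pi) (hθ : 0 < θ) {f : ℂ → ℂ}
    (hf : MemH0 ψ f) {u : ℂ} (hu : θ < |u.im|) (hu' : |u.im| < ψ) :
    scalarCauchy f (-θ) u - scalarCauchy f θ u = 0 := by
  obtain ⟨C, hC, s, hs, h⟩ := hf.exists_norm_exp_le hψ
  have huπ : |u.im| < Real.pi := hu'.trans_le hψ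
  have hstrip (v : ℂ) (h1 : -θ ≤ v.im) (h2 : v.im ≤ θ) : |v.im| < |u.im| :=
    (abs_le.2 ⟨h1, h2⟩).trans_lt hu
  -- The strip is cut at the height of u, which keeps the pole out.
  have hd : DifferentiableOn ℂ (fun w => f (exp w) * kernel u w) {w : ℂ | |w.im| < |u.im|} :=
    ((differentiableOn_comp_exp hψ hf.1).mono fun w (hw : _ < _) => hw.trans hu').mul
      (differentiable_exp.differentiableOn.div
        (differentiable_exp.sub_const _).differentiableOn fun w (hw : _ < _) =>
          sub_ne_zero.2 (exp_ne_exp huπ (hw.trans huπ) fun h => by simp [h] at hw))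
  exact sub_eq_zero.2 (lineIntegral_eq_lineIntegral (isOpen_abs_im_lt _) hs (neg_lt_self hθ)
    hstrip hd fun v h1 h2 h3 => scalarCauchy_bound h ((hstrip v h1 h2).trans hu') h3)

end Kernel

/-! ### Multiplicativity of the primary calculus. -/

section Multiplicative

variable {X : Type*} [NormedAddCommGroup X] [NormedSpace ℂ X] {A : X →ₗ.[ℂ] X} {ω : ℝ}

theorem cos_sub_lt_one {ψ α β : ℝ} (hψ : ψ ≤ Real.pi) (hα : |α| < ψ) (hβ : |β| < ψ)
    (hne : α ≠ β) : Real.cos (β - α) < 1 := by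
  rw [abs_lt] at hα hβ
  refine lt_of_le_of_ne (Real.cos_le_one _) fun h => hne ?_
  rw [Real.cos_eq_one_iff_of_lt_of_lt (by linarith) (by linarith)] at h
  linarith

/-- Distinct heights correspond to distinct rays, between which the kernel is uniformly bounded; the
decay of f and g then dominates. This justifies Fubini. -/
theorem MemH0.integrable_prod (hA : IsSect ω A) (h0 : 0 < ω) {ψ α β : ℝ} (hψ : ψ ≤ Real.pi)
    {f g : ℂ → ℂ} (hf : MemH0 ψ f) (hg : MemH0 ψ g)
    (hα : ω < |α|) (hα' : |α| < ψ)
    (hβ : |β| < ψ) (hne : α ≠ β) :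
    Integrable (fun p : ℝ × ℝ => (g (exp (p.2 + β * I)) * kernel (p.1 + α * I) (p.2 + β * I)) •
      integrand A f (p.1 + α * I)) (volume.prod volume) := by
  obtain ⟨C, s, hs, h⟩ := hf.exists_norm_integrand_le hA hψ
  obtain ⟨C', hC', s', hs', h'⟩ := hg.exists_norm_exp_le hψ
  obtain ⟨K, hK, hker⟩ := exists_norm_kernel_le (cos_sub_lt_one hψ hα' hβ hne)
  have hωψ := hα.trans hα'
  have hmem (t : ℝ) := abs_im_mem (v := t + α * I) h0 hωψ hψ (by simpa) (by simpa)
  have hker' (t t' : ℝ) : ‖exp (t' + β * I)‖ + ‖exp (t + α * I)‖ ≤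
      K * ‖exp (t' + β * I) - exp (t + α * I)‖ := hker _ _ (by simp)
  have hpos (t t' : ℝ) : 0 < ‖exp (t' + β * I) - exp (t + α * I)‖ := by
    have h1 := hker' t t'
    have h2 : 0 < ‖exp (t' + β * I)‖ := norm_pos_iff.2 (exp_ne_zero _)
    exact pos_of_mul_pos_right (lt_of_lt_of_le (by positivity) h1) hK.le
  have hkn (t t' : ℝ) : ‖kernel (t + α * I) (t' + β * I)‖ ≤ K := by
    rw [kernel, norm_div, div_le_iff₀ (hpos t t')]
    linarith [hker' t t', norm_nonneg (exp (t + α * I))]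
  have hcf : Continuous fun t : ℝ => integrand A f (t + α * I) :=
    continuous_line (differentiableOn_integrand hA h0 hωψ hψ hf.1) hmem
  have hcg : Continuous fun t : ℝ => g (exp (t + β * I)) :=
    continuous_line (Φ := fun v => g (exp v)) (differentiableOn_comp_exp hψ hg.1)
      fun t => by simpa
  have hck : Continuous fun p : ℝ × ℝ => kernel (p.1 + α * I) (p.2 + β * I) := by
    unfold kernel
    exact Continuous.div (by fun_prop) (by fun_prop) fun p => norm_pos_iff.1 (hpos p.1 p.2)
  have hdom := ((integrable_exp_neg_mul_abs hs).mul_prod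
    (integrable_exp_neg_mul_abs hs')).const_mul (C' * K * C)
  refine hdom.mono' (((hcg.comp continuous_snd).mul hck).smul
    (hcf.comp continuous_fst)).aestronglyMeasurable (ae_of_all _ fun p => ?_)
  have h1 : ‖g (exp (p.2 + β * I))‖ ≤ C' * Real.exp (-s' * |p.2|) := by
    simpa using h' (p.2 + β * I) (by simpa)
  have h2 : ‖integrand A f (p.1 + α * I)‖ ≤ C * Real.exp (-s * |p.1|) := by
    simpa using h _ (hmem p.1)
  rw [norm_smul, norm_mul]
  calc _ ≤ (C' * Real.exp (-s' * |p.2|) * K) * (C * Real.exp (-s * |p.1|)) := by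
        gcongr
        exact hkn _ _
    _ = _ := by ring

/-- The mixed integral arising from the resolvent identity. -/
noncomputable def mixedIntegral (A : X →ₗ.[ℂ] X) (g : ℂ → ℂ) (β : ℝ) (f : ℂ → ℂ) (α : ℝ) :
    X →L[ℂ] X :=
  lineIntegral (fun v => scalarCauchy g β v • integrand A f v) α

theorem integral_prod_kernel [CompleteSpace X] (f g : ℂ → ℂ) (α β t : ℝ) :
    ∫ t' : ℝ, (g (exp (t' + β * I)) * kernel (t + α * I) (t' + β * I)) •
      integrand A f (t + α * I) =
    scalarCauchy g β (t + α * I) • integrand A f (t + α * I) :=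
  integral_smul_const _ _

theorem lineIntegral_mul_lineIntegral [CompleteSpace X] (hA : IsSect ω A) (h0 : 0 < ω)
    {ψ α β : ℝ} (hψ : ψ ≤ Real.pi) {f g : ℂ → ℂ} (hf : MemH0 ψ f) (hg : MemH0 ψ g)
    (hα : ω < |α|) (hα' : |α| < ψ) (hβ : ω < |β|) (hβ' : |β| < ψ) (hne : α ≠ β) :
    lineIntegral (integrand A f) α * lineIntegral (integrand A g) β =
      mixedIntegral A g β f α + mixedIntegral A f α g β := by
  have hωψ := hα.trans hα'
  have hi1 := hf.integrable_prod hA h0 hψ hg hα hα' hβ' hne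
  have hi2 := (hg.integrable_prod hA h0 hψ hf hβ hβ' hα' hne.symm).swap
  have hpt (t t' : ℝ) : integrand A f (t + α * I) * integrand A g (t' + β * I) =
      (g (exp (t' + β * I)) * kernel (t + α * I) (t' + β * I)) • integrand A f (t + α * I) +
      (f (exp (t + α * I)) * kernel (t' + β * I) (t + α * I)) • integrand A g (t' + β * I) := by
    have hv := (abs_im_mem (v := t + α * I) h0 hωψ hψ (by simpa) (by simpa)).2
    have hw := (abs_im_mem (v := t' + β * I) h0 hωψ hψ (by simpa) (by simpa)).2
    have hvw : exp (t' + β * I) ≠ exp (t + α * I) :=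
      exp_ne_exp (by simpa using hα'.trans_le hψ) (by simpa using hβ'.trans_le hψ) fun h =>
        hne (by simpa using (congrArg im h).symm)
    rw [kernel_swap (t' + β * I), kernel]
    simp only [integrand, smul_mul_smul_comm, hA.logRes_mul_logRes hv hw hvw, smul_smul]
    module
  have hprod : lineIntegral (integrand A f) α * lineIntegral (integrand A g) β =
      ∫ t : ℝ, ∫ t' : ℝ, integrand A f (t + α * I) * integrand A g (t' + β * I) := by
    have hif := hf.integrable_integrand hA h0 hωψ hψ hα hα'
    have hig := hg.integrable_integrand hA h0 hωψ hψ hβ hβ'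
    have h1 (S : X →L[ℂ] X) : S * lineIntegral (integrand A g) β =
        ∫ t' : ℝ, S * integrand A g (t' + β * I) :=
      ((ContinuousLinearMap.mul ℂ (X →L[ℂ] X) S).integral_comp_comm hig).symm
    have h2 : lineIntegral (integrand A f) α * lineIntegral (integrand A g) β =
        ∫ t : ℝ, integrand A f (t + α * I) * lineIntegral (integrand A g) β :=
      (((ContinuousLinearMap.mul ℂ (X →L[ℂ] X)).flip
        (lineIntegral (integrand A g) β)).integral_comp_comm hif).symm
    rw [h2]
    exact integral_congr_ae (ae_of_all _ fun t => h1 _)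
  rw [hprod]
  simp only [hpt]
  refine (integral_integral_add hi1 hi2).trans ?_
  congr 1
  · exact integral_congr_ae (ae_of_all _ fun t => integral_prod_kernel f g α β t)
  · refine (integral_integral_swap (f := fun t t' : ℝ => (f (exp (t + α * I)) *
      kernel (t' + β * I) (t + α * I)) • integrand A g (t' + β * I)) hi2).trans ?_
    exact integral_congr_ae (ae_of_all _ fun t => integral_prod_kernel g f β α t)

theorem mixedIntegral_sub [CompleteSpace X] (hA : IsSect ω A) (h0 : 0 < ω) {ψ α θ : ℝ}
    (hψ : ψ ≤ Real.pi) {f g : ℂ → ℂ} (hf : MemH0 ψ f) (hg : MemH0 ψ g)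
    (hα : ω < |α|) (hα' : |α| < ψ)
    (hθ : 0 < θ) (hθ' : θ < ψ) (h1 : α ≠ -θ) (h2 : α ≠ θ) :
    mixedIntegral A g (-θ) f α - mixedIntegral A g θ f α =
      lineIntegral (fun v => (scalarCauchy g (-θ) v - scalarCauchy g θ v) • integrand A f v) α := by
  have hi {β : ℝ} (hβ : |β| < ψ) (hne : α ≠ β) := by
    simpa only [integral_prod_kernel] using
      (hf.integrable_prod hA h0 hψ hg hα hα' hβ hne).integral_prod_left
  unfold mixedIntegral lineIntegral
  rw [← integral_sub (hi (by rwa [abs_neg, abs_of_pos hθ]) h1) (hi (by rwa [abs_of_pos hθ]) h2)]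
  simp only [sub_smul]

/-- The line at height α lies inside the contour of angle θ, so Cauchy's formula reproduces g on it.
For a line outside, the scalar integral vanishes instead. -/
theorem mixedIntegral_sub_of_lt [CompleteSpace X] (hA : IsSect ω A) (h0 : 0 < ω) {ψ α θ : ℝ}
    (hψ : ψ ≤ Real.pi) {f g : ℂ → ℂ} (hf : MemH0 ψ f) (hg : MemH0 ψ g)
    (hα : ω < |α|) (hαθ : |α| < θ)
    (hθ' : θ < ψ) :
    mixedIntegral A g (-θ) f α - mixedIntegral A g θ f α =
      (2 * Real.pi * I) • lineIntegral (integrand A (f * g)) α := by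
  rw [mixedIntegral_sub hA h0 hψ hf hg hα (hαθ.trans hθ') (by linarith [abs_nonneg α]) hθ'
    (abs_lt.1 hαθ).1.ne' (abs_lt.1 hαθ).2.ne]
  unfold lineIntegral
  rw [← integral_smul]
  congr 1
  ext1 t
  beta_reduce
  rw [scalarCauchy_sub_of_lt hψ hθ' hg (by simpa), integrand, integrand, smul_smul, smul_smul,
    Pi.mul_apply]
  congr 1
  ring

theorem mixedIntegral_sub_of_gt [CompleteSpace X] (hA : IsSect ω A) (h0 : 0 < ω) {ψ α θ : ℝ}
    (hψ : ψ ≤ Real.pi) {f g : ℂ → ℂ} (hf : MemH0 ψ f) (hg : MemH0 ψ g)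
    (hα : ω < |α|) (hα' : |α| < ψ)
    (hθ : 0 < θ) (hαθ : θ < |α|) :
    mixedIntegral A g (-θ) f α - mixedIntegral A g θ f α = 0 := by
  rw [mixedIntegral_sub hA h0 hψ hf hg hα hα' hθ (hαθ.trans hα')
    (fun h => by simp [h, abs_of_pos hθ] at hαθ) (fun h => by simp [h, abs_of_pos hθ] at hαθ)]
  unfold lineIntegral
  rw [← integral_zero ℝ (X →L[ℂ] X)]
  congr 1
  ext1 t
  beta_reduce
  rw [scalarCauchy_sub_of_gt hψ hθ hg (by simpa) (by simpa), zero_smul]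

/-- The primary calculus is multiplicative. -/
theorem cauchy_mul_cauchy [CompleteSpace X] (hA : IsSect ω A) (h0 : 0 < ω) {ψ θ : ℝ}
    (hψ : ψ ≤ Real.pi) {f g : ℂ → ℂ} (hf : MemH0 ψ f) (hg : MemH0 ψ g) (h1 : ω < θ)
    (h2 : θ < ψ) : cauchy A θ f * cauchy A θ g = cauchy A θ (f * g) := by
  -- The integral of g is moved to a larger angle, so that the contour of f lies strictly inside
  -- that of g.
  obtain ⟨θ', h3, h4⟩ := exists_between h2
  have hθ : |θ| = θ := abs_of_pos (by linarith)
  have hθ' : |θ'| = θ' := abs_of_pos (by linarith)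
  have hP {α β : ℝ} (hα : |α| = θ) (hβ : |β| = θ') := lineIntegral_mul_lineIntegral hA h0 hψ hf hg
    (α := α) (β := β) (by linarith) (by linarith) (by linarith) (by linarith)
    (fun h => by rw [h] at hα; linarith)
  have hF {α : ℝ} (hα : |α| = θ) := mixedIntegral_sub_of_lt hA h0 hψ hf hg (α := α) (θ := θ')
    (by linarith) (by linarith) h4
  have hG {β : ℝ} (hβ : |β| = θ') := mixedIntegral_sub_of_gt hA h0 hψ hg hf (α := β) (θ := θ)
    (by linarith) (by linarith) (by linarith) (by linarith)
  have hneg : |-θ| = θ := by rw [abs_neg, hθ]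
  have hneg' : |-θ'| = θ' := by rw [abs_neg, hθ']
  rw [cauchy_eq_cauchy hA h0 hψ hg h1 h2 (h1.trans h3) h4, cauchy_eq, cauchy_eq, cauchy_eq,
    smul_mul_smul_comm, sub_mul, mul_sub, mul_sub, hP hneg hneg', hP hneg hθ', hP hθ hneg',
    hP hθ hθ']
  -- Of the eight mixed terms, those integrating out g reproduce fg on the inner contour; those
  -- integrating out f cancel, since the outer lines lie outside the inner contour.
  have e : mixedIntegral A g (-θ') f (-θ) + mixedIntegral A f (-θ) g (-θ') -
      (mixedIntegral A g θ' f (-θ) + mixedIntegral A f (-θ) g θ') -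
      (mixedIntegral A g (-θ') f θ + mixedIntegral A f θ g (-θ') -
      (mixedIntegral A g θ' f θ + mixedIntegral A f θ g θ')) =
      (2 * Real.pi * I) • (lineIntegral (integrand A (f * g)) (-θ) -
        lineIntegral (integrand A (f * g)) θ) := by
    rw [smul_sub, ← hF hneg, ← hF hθ]
    have e1 := hG hθ'
    have e2 := hG hneg'
    rw [sub_eq_zero] at e1 e2
    rw [e1, e2]
    abel
  rw [e, smul_smul, mul_assoc, inv_mul_cancel₀ two_pi_I_ne_zero, mul_one]

end Multiplicative

/-! ### Algebra of the growth classes. -/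

section Growth

/-- In this form, multiplying bounds just adds exponents. -/
theorem min_rpow_eq {r s : ℝ} (hr : 0 < r) (hs : 0 ≤ s) :
    min (r ^ s) (r ^ (-s)) = Real.exp (-s * |Real.log r|) := by
  rw [Real.rpow_def_of_pos hr, Real.rpow_def_of_pos hr]
  rcases abs_cases (Real.log r) with ⟨h, h'⟩ | ⟨h, h'⟩ <;> rw [h]
  · rw [min_eq_right (Real.exp_le_exp.2 (by nlinarith))]; ring_nf
  · rw [min_eq_left (Real.exp_le_exp.2 (by nlinarith))]; ring_nf

theorem max_rpow_eq {r s : ℝ} (hr : 0 < r) (hs : 0 ≤ s) :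
    max (r ^ s) (r ^ (-s)) = Real.exp (s * |Real.log r|) := by
  rw [Real.rpow_def_of_pos hr, Real.rpow_def_of_pos hr]
  rcases abs_cases (Real.log r) with ⟨h, h'⟩ | ⟨h, h'⟩ <;> rw [h]
  · rw [max_eq_left (Real.exp_le_exp.2 (by nlinarith))]; ring_nf
  · rw [max_eq_right (Real.exp_le_exp.2 (by nlinarith))]; ring_nf

theorem norm_pos_of_mem_sector {ψ : ℝ} {z : ℂ} (hz : z ∈ sector ψ) : 0 < ‖z‖ :=
  norm_pos_iff.2 hz.1

theorem memH0_iff {ψ : ℝ} {f : ℂ → ℂ} : MemH0 ψ f ↔ DifferentiableOn ℂ f (sector ψ) ∧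
    ∃ C > (0 : ℝ), ∃ s > (0 : ℝ), ∀ z ∈ sector ψ, ‖f z‖ ≤ C * Real.exp (-s * |Real.log ‖z‖|) := by
  refine and_congr_right fun _ => exists_congr fun C => and_congr_right fun _ =>
    exists_congr fun s => and_congr_right fun hs => forall₂_congr fun z hz => ?_
  rw [min_rpow_eq (norm_pos_of_mem_sector hz) (le_of_lt hs)]

theorem memB_iff {ψ : ℝ} {f : ℂ → ℂ} : MemB ψ f ↔ DifferentiableOn ℂ f (sector ψ) ∧
    ∃ C > (0 : ℝ), ∃ s > (0 : ℝ), ∀ z ∈ sector ψ, ‖f z‖ ≤ C * Real.exp (s * |Real.log ‖z‖|) := by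
  refine and_congr_right fun _ => exists_congr fun C => and_congr_right fun _ =>
    exists_congr fun s => and_congr_right fun hs => forall₂_congr fun z hz => ?_
  rw [max_rpow_eq (norm_pos_of_mem_sector hz) (le_of_lt hs)]

theorem sector_mono {ψ ψ' : ℝ} (h : ψ ≤ ψ') : sector ψ ⊆ sector ψ' :=
  fun _ hz => ⟨hz.1, hz.2.trans_le h⟩

variable {ψ : ℝ} {f g : ℂ → ℂ}

theorem MemH0.mono {ψ' : ℝ} (hf : MemH0 ψ f) (h : ψ' ≤ ψ) : MemH0 ψ' f := by
  obtain ⟨hd, C, hC, s, hs, hb⟩ := hf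
  exact ⟨hd.mono (sector_mono h), C, hC, s, hs, fun z hz => hb z (sector_mono h hz)⟩

theorem MemB.mono {ψ' : ℝ} (hf : MemB ψ f) (h : ψ' ≤ ψ) : MemB ψ' f := by
  obtain ⟨hd, C, hC, s, hs, hb⟩ := hf
  exact ⟨hd.mono (sector_mono h), C, hC, s, hs, fun z hz => hb z (sector_mono h hz)⟩

theorem MemH0.congr (hf : MemH0 ψ f) (h : EqOn g f (sector ψ)) : MemH0 ψ g := by
  obtain ⟨hd, C, hC, s, hs, hb⟩ := hf
  exact ⟨hd.congr h, C, hC, s, hs, fun z hz => by rw [h hz]; exact hb z hz⟩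

theorem MemH0.mul (hf : MemH0 ψ f) (hg : MemH0 ψ g) : MemH0 ψ (f * g) := by
  obtain ⟨hd, C, hC, s, hs, hb⟩ := memH0_iff.1 hf
  obtain ⟨hd', C', hC', s', hs', hb'⟩ := memH0_iff.1 hg
  refine memH0_iff.2 ⟨hd.mul hd', C * C', by positivity, s + s', by positivity, fun z hz => ?_⟩
  rw [Pi.mul_apply, norm_mul]
  refine (mul_le_mul (hb z hz) (hb' z hz) (norm_nonneg _) (by positivity)).trans_eq ?_
  rw [mul_mul_mul_comm, ← Real.exp_add]
  ring_nf

theorem MemH0.add (hf : MemH0 ψ f) (hg : MemH0 ψ g) : MemH0 ψ (f + g) := by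
  obtain ⟨hd, C, hC, s, hs, hb⟩ := memH0_iff.1 hf
  obtain ⟨hd', C', hC', s', hs', hb'⟩ := memH0_iff.1 hg
  refine memH0_iff.2 ⟨hd.add hd', C + C', by positivity, min s s', lt_min hs hs', fun z hz => ?_⟩
  refine (norm_add_le _ _).trans ?_
  rw [add_mul]
  refine add_le_add ((hb z hz).trans ?_) ((hb' z hz).trans ?_) <;> gcongr
  exacts [min_le_left _ _, min_le_right _ _]

theorem MemB.mul (hf : MemB ψ f) (hg : MemB ψ g) : MemB ψ (f * g) := by
  obtain ⟨hd, C, hC, s, hs, hb⟩ := memB_iff.1 hf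
  obtain ⟨hd', C', hC', s', hs', hb'⟩ := memB_iff.1 hg
  refine memB_iff.2 ⟨hd.mul hd', C * C', by positivity, s + s', by positivity, fun z hz => ?_⟩
  rw [Pi.mul_apply, norm_mul]
  refine (mul_le_mul (hb z hz) (hb' z hz) (norm_nonneg _) (by positivity)).trans_eq ?_
  rw [mul_mul_mul_comm, ← Real.exp_add]
  ring_nf

theorem MemB.add (hf : MemB ψ f) (hg : MemB ψ g) : MemB ψ (f + g) := by
  obtain ⟨hd, C, hC, s, hs, hb⟩ := memB_iff.1 hf
  obtain ⟨hd', C', hC', s', hs', hb'⟩ := memB_iff.1 hg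
  refine memB_iff.2 ⟨hd.add hd', C + C', by positivity, max s s', lt_max_of_lt_left hs,
    fun z hz => ?_⟩
  refine (norm_add_le _ _).trans ?_
  rw [add_mul]
  refine add_le_add ((hb z hz).trans ?_) ((hb' z hz).trans ?_) <;> gcongr
  exacts [le_max_left _ _, le_max_right _ _]

theorem memB_const (ψ : ℝ) (c : ℂ) : MemB ψ fun _ => c := by
  refine memB_iff.2 ⟨differentiableOn_const c, ‖c‖ + 1, by positivity, 1, one_pos, fun z _ => ?_⟩
  have : 1 ≤ Real.exp (1 * |Real.log ‖z‖|) := Real.one_le_exp (by positivity)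
  nlinarith [norm_nonneg c]

theorem MemB.polynomial_eval (hf : MemB ψ f) (q : Polynomial ℂ) :
    MemB ψ fun z => q.eval (f z) := by
  induction q using Polynomial.induction_on' with
  | add p q hp hq =>
    simp only [Polynomial.eval_add]
    exact hp.add hq
  | monomial n a =>
    simp only [Polynomial.eval_monomial]
    refine (memB_const ψ a).mul ?_
    induction n with
    | zero => simpa only [pow_zero] using memB_const ψ 1
    | succ n ih =>
      simp only [pow_succ]
      exact ih.mul hf

end Growth

/-! ### An explicit injective regulariser. -/

section BasicRegulariser

/-- The rational function `z / ((z - exp (i β)) (z - exp (-i β)))`. -/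
noncomputable def basicReg (β : ℝ) (z : ℂ) : ℂ :=
  z / ((z - exp (β * I)) * (z - exp (-β * I)))

theorem cos_le_cos_of_abs {δ x : ℝ} (h0 : 0 ≤ δ) (h1 : δ ≤ |x|) (h2 : |x| ≤ 2 * Real.pi - δ) :
    Real.cos x ≤ Real.cos δ := by
  rw [← Real.cos_abs x]
  rcases le_total |x| Real.pi with h | h
  · exact Real.cos_le_cos_of_nonneg_of_le_pi h0 h h1
  · rw [← Real.cos_two_pi_sub]
    exact Real.cos_le_cos_of_nonneg_of_le_pi h0 (by linarith) (by linarith)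

/-- The poles have modulus 1 and make an angle of at least β − ψ with the sector, so each factor of
the denominator is bounded below by a multiple of |z| + 1. -/
theorem exists_memH0_basicReg_bound {ψ β : ℝ} (hψ : 0 < ψ) (hβ : ψ < β) (hβπ : β < Real.pi) :
    ∃ C > (0 : ℝ), ∀ z ∈ sector ψ, (z - exp (β * I)) * (z - exp (-β * I)) ≠ 0 ∧
      ‖basicReg β z‖ ≤ C * Real.exp (-1 * |Real.log ‖z‖|) := by
  have hc : Real.cos (β - ψ) < 1 := by
    rw [← Real.cos_zero]
    exact Real.cos_lt_cos_of_nonneg_of_le_pi le_rfl (by linarith) (by linarith)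
  obtain ⟨K, hK, hker⟩ := exists_norm_kernel_le hc
  refine ⟨K ^ 2, by positivity, fun z hz => ?_⟩
  have hn := norm_pos_of_mem_sector hz
  have hstep {b : ℝ} (hb : |b| = β) : ‖z‖ + 1 ≤ K * ‖z - exp (b * I)‖ := by
    have h := hker (b * I) (log z) (cos_le_cos_of_abs (by linarith) ?_ ?_)
    · rwa [exp_log hz.1, norm_exp_ofReal_mul_I] at h
    all_goals
      have h1 := hz.2
      simp only [log_im, mul_im, ofReal_re, I_im, mul_one, ofReal_im, I_re, mul_zero, add_zero]
    · linarith [abs_sub_abs_le_abs_sub b z.arg, abs_sub_comm b z.arg]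
    · linarith [abs_sub z.arg b]
  have hβ0 : |β| = β := abs_of_pos (by linarith)
  have h1 := hstep hβ0
  have h2 := hstep (b := -β) (by rw [abs_neg, hβ0])
  rw [ofReal_neg] at h2
  have h3 : (‖z‖ + 1) ^ 2 ≤ K ^ 2 * ‖(z - exp (β * I)) * (z - exp (-β * I))‖ := by
    rw [norm_mul, sq, sq, mul_mul_mul_comm]
    exact mul_le_mul h1 h2 (by positivity) (by positivity)
  have h4 : 0 < ‖(z - exp (β * I)) * (z - exp (-β * I))‖ :=
    pos_of_mul_pos_right (lt_of_lt_of_le (by positivity) h3) (by positivity)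
  refine ⟨norm_pos_iff.1 h4, ?_⟩
  have h5 : ‖z‖ ≤ (‖z‖ + 1) ^ 2 * Real.exp (-1 * |Real.log ‖z‖|) := by
    rw [← min_rpow_eq hn zero_le_one, Real.rpow_one, Real.rpow_neg_one]
    rcases min_cases ‖z‖ ‖z‖⁻¹ with ⟨h, -⟩ | ⟨h, -⟩ <;> rw [h]
    · nlinarith [mul_pos hn hn, mul_pos (mul_pos hn hn) hn]
    · rw [← div_eq_mul_inv, le_div_iff₀ hn]; nlinarith
  rw [basicReg, norm_div, div_le_iff₀ h4]
  calc ‖z‖ ≤ _ := h5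
    _ ≤ (K ^ 2 * ‖(z - exp (β * I)) * (z - exp (-β * I))‖) * Real.exp (-1 * |Real.log ‖z‖|) := by
      gcongr
    _ = _ := by ring

theorem differentiableOn_basicReg {ψ β : ℝ} (hψ : 0 < ψ) (hβ : ψ < β) (hβπ : β < Real.pi) :
    DifferentiableOn ℂ (basicReg β) (sector ψ) := by
  obtain ⟨C, -, h⟩ := exists_memH0_basicReg_bound hψ hβ hβπ
  exact DifferentiableOn.div (by fun_prop) (by fun_prop) fun z hz => (h z hz).1

theorem exists_memH0_basicReg_pow_mul {ψ β : ℝ} (hψ : 0 < ψ) (hβ : ψ < β) (hβπ : β < Real.pi)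
    {f : ℂ → ℂ} (hf : MemB ψ f) : ∃ N : ℕ, ∀ n ≥ N, MemH0 ψ (basicReg β ^ n * f) := by
  obtain ⟨C, hC, h⟩ := exists_memH0_basicReg_bound hψ hβ hβπ
  obtain ⟨hd, C', hC', s, hs, hb⟩ := memB_iff.1 hf
  obtain ⟨N, hN⟩ := exists_nat_gt s
  refine ⟨N, fun n hn => memH0_iff.2 ⟨((differentiableOn_basicReg hψ hβ hβπ).pow n).mul hd,
    C ^ n * C', by positivity, n - s, sub_pos.2 (hN.trans_le (by exact_mod_cast hn)),
    fun z hz => ?_⟩⟩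
  rw [Pi.mul_apply, Pi.pow_apply, norm_mul, norm_pow]
  calc _ ≤ (C * Real.exp (-1 * |Real.log ‖z‖|)) ^ n * (C' * Real.exp (s * |Real.log ‖z‖|)) := by
        gcongr
        exacts [(h z hz).2, hb z hz]
    _ = _ := by
        rw [mul_pow, ← Real.exp_nat_mul, mul_mul_mul_comm, ← Real.exp_add]
        ring_nf

theorem memH0_basicReg {ψ β : ℝ} (hψ : 0 < ψ) (hβ : ψ < β) (hβπ : β < Real.pi) :
    MemH0 ψ (basicReg β) := by
  obtain ⟨C, hC, h⟩ := exists_memH0_basicReg_bound hψ hβ hβπ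
  exact memH0_iff.2 ⟨differentiableOn_basicReg hψ hβ hβπ, C, hC, 1, one_pos,
    fun z hz => (h z hz).2⟩

variable {X : Type*} [NormedAddCommGroup X] [NormedSpace ℂ X] {A : X →ₗ.[ℂ] X} {ω : ℝ}

theorem exists_int_im_eq {u w : ℂ} (h : exp w = exp u) :
    ∃ n : ℤ, w.im = u.im + n * (2 * Real.pi) := by
  obtain ⟨n, rfl⟩ := exp_eq_exp_iff_exists_int.1 h
  exact ⟨n, by simp⟩

theorem eq_of_exp_eq_exp {u w : ℂ} (h : exp w = exp u) (him : |w.im - u.im| < 2 * Real.pi) :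
    w = u := by
  obtain ⟨n, hn⟩ := exp_eq_exp_iff_exists_int.1 h
  have him' : w.im = u.im + n * (2 * Real.pi) := by rw [hn]; simp
  rw [him', add_sub_cancel_left, abs_mul, abs_of_pos Real.two_pi_pos] at him
  have : |(n : ℝ)| < 1 := by
    by_contra h1
    exact absurd him (not_lt.2 (le_mul_of_one_le_left Real.two_pi_pos.le (not_lt.1 h1)))
  have hn0 : n = 0 := Int.abs_lt_one_iff.1 (by exact_mod_cast this)
  rw [hn, hn0]; simp

theorem norm_exp_div_le {w ζ ξ : ℂ} (hζ : ‖ζ‖ = 1) (hξ : ‖ξ‖ = 1) (hre : 1 ≤ |w.re|) :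
    ‖exp w / ((exp w - ζ) * (exp w - ξ))‖ ≤
      ((1 - Real.exp (-1)) ^ 2)⁻¹ * Real.exp (-1 * |w.re|) := by
  have he : 0 < 1 - Real.exp (-1) := by
    have := Real.exp_lt_one_iff.2 (show (-1 : ℝ) < 0 by norm_num); linarith
  have hw : 0 < ‖exp w‖ := norm_pos_iff.2 (exp_ne_zero w)
  -- Here d is the larger of 1 and |exp w|, the size of each factor of the denominator.
  obtain ⟨d, hd, hdist, hdd⟩ : ∃ d : ℝ, 0 < d ∧ (∀ η : ℂ, ‖η‖ = 1 → (1 - Real.exp (-1)) * d ≤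
      ‖exp w - η‖) ∧ ‖exp w‖ = Real.exp (-1 * |w.re|) * d ^ 2 := by
    rcases le_abs.1 hre with h | h
    · refine ⟨‖exp w‖, hw, fun η hη => le_trans ?_ (norm_sub_norm_le _ _), ?_⟩
      · have : 1 ≤ Real.exp (-1) * ‖exp w‖ := by
          rw [norm_exp, ← Real.exp_add]; exact Real.one_le_exp (by linarith)
        rw [hη]; linarith
      · rw [norm_exp, ← Real.exp_nat_mul, ← Real.exp_add, abs_of_pos (by linarith)]
        congr 1; push_cast; ring
    · refine ⟨1, one_pos, fun η hη => ?_, ?_⟩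
      · rw [norm_sub_rev]
        refine le_trans ?_ (norm_sub_norm_le _ _)
        have : ‖exp w‖ ≤ Real.exp (-1) := by
          rw [norm_exp]; exact Real.exp_le_exp.2 (by linarith)
        rw [hη]; linarith
      · rw [norm_exp, abs_of_neg (by linarith)]; simp
  have h1 : ((1 - Real.exp (-1)) * d) ^ 2 ≤ ‖(exp w - ζ) * (exp w - ξ)‖ := by
    rw [norm_mul, sq]
    exact mul_le_mul (hdist ζ hζ) (hdist ξ hξ) (by positivity) (norm_nonneg _)
  rw [norm_div, div_le_iff₀ (lt_of_lt_of_le (by positivity) h1), hdd]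
  calc Real.exp (-1 * |w.re|) * d ^ 2 = ((1 - Real.exp (-1)) ^ 2)⁻¹ * Real.exp (-1 * |w.re|) *
        ((1 - Real.exp (-1)) * d) ^ 2 := by field_simp
    _ ≤ _ := by gcongr

/-- The closed strip is mapped by exp into the resolvent set, so the only singularity there is the
pole of e at height γ. -/
theorem IsSect.lineIntegral_integrand_sub [CompleteSpace X] (hA : IsSect ω A) (h0 : 0 < ω)
    (hπ : ω < Real.pi) {a b γ : ℝ} (ha : ω < a) (hb : b < 2 * Real.pi - ω) (haγ : a < γ)
    (hγb : γ < b) {e : ℂ → ℂ} {ζ : ℂ} (hζ : ‖ζ‖ = 1)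
    (hζ' : ∀ w : ℂ, a ≤ w.im → w.im ≤ b → exp w ≠ ζ)
    (he : ∀ z, e z = z / ((z - exp (γ * I)) * (z - ζ))) :
    lineIntegral (integrand A e) a - lineIntegral (integrand A e) b =
      (2 * Real.pi * I) • ((exp (γ * I) - ζ)⁻¹ • logRes A (γ * I)) := by
  obtain ⟨M, hM, hM'⟩ := hA.exists_norm_logRes_le
  have hres (w : ℂ) (h1 : a ≤ w.im) (h2 : w.im ≤ b) : exp w ∈ (closedSector ω)ᶜ := by
    have : |w.im| = w.im := abs_of_pos (by linarith)
    exact exp_mem_compl_closedSector h0 hπ (by linarith) (by linarith)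
  have hne (w : ℂ) (h1 : a ≤ w.im) (h2 : w.im ≤ b) (h : w ≠ γ * I) : exp w ≠ exp (γ * I) :=
    fun h' => h (eq_of_exp_eq_exp h' (by rw [abs_lt]; simp; constructor <;> linarith))
  let U : Set ℂ := {w | exp w ≠ ζ} ∩ {w | dslope exp (γ * I) w ≠ 0} ∩
    exp ⁻¹' (closedSector ω)ᶜ
  have hU : IsOpen U := ((isOpen_ne_fun continuous_exp continuous_const).inter
    (isOpen_ne_fun (differentiable_dslope_exp _).continuous continuous_const)).inter
    (isOpen_logRes_domain h0 hπ)
  have hG : DifferentiableOn ℂ (fun w => ((exp w - ζ)⁻¹ * (exp w / dslope exp (γ * I) w)) •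
      logRes A w) U := by
    have hd1 : DifferentiableOn ℂ (fun w => (exp w - ζ)⁻¹) U :=
      DifferentiableOn.fun_inv (by fun_prop) fun w hw => sub_ne_zero.2 hw.1.1
    have hd2 : DifferentiableOn ℂ (fun w => exp w / dslope exp (γ * I) w) U :=
      differentiable_exp.differentiableOn.div (differentiable_dslope_exp _).differentiableOn
        fun w hw => hw.1.2
    exact (hd1.mul hd2).smul ((hA.differentiableOn_logRes h0 hπ).mono inter_subset_right)
  rw [lineIntegral_sub_lineIntegral (u := γ * I) (C := ((1 - Real.exp (-1)) ^ 2)⁻¹ * M) hU one_pos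
    (by simpa) (by simpa)
    (fun w h1 h2 => ⟨⟨hζ' w h1 h2, dslope_exp_ne_zero (hne w h1 h2)⟩, hres w h1 h2⟩) hG
    (fun w h1 h2 h => ?_) (fun w h1 h2 h => ?_), dslope_same, Complex.deriv_exp,
    div_self (exp_ne_zero _), mul_one]
  · rw [smul_smul, integrand, he, mul_left_comm, ← kernel_eq h, kernel]
    congr 1
    rw [div_eq_mul_inv, div_eq_mul_inv, mul_inv]
    ring
  · rw [integrand, norm_smul, he, mul_right_comm]
    refine mul_le_mul (norm_exp_div_le (norm_exp_ofReal_mul_I γ) hζ (by simpa using h))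
      (hM' w (hres w h1 h2)) (norm_nonneg _) (by positivity)

/-- The contour is closed on the side away from the spectrum: by periodicity of exp the line at −θ
is the line at 2π − θ, and the strip from θ to 2π − θ, cut at π, has one pole in each half. -/
theorem IsSect.cauchy_basicReg [CompleteSpace X] (hA : IsSect ω A) (h0 : 0 < ω) {θ β : ℝ}
    (h1 : ω < θ) (h2 : θ < β) (h3 : β < Real.pi) :
    cauchy A θ (basicReg β) = (exp (β * I) - exp (-β * I))⁻¹ •
      (exp (-β * I) • res A (exp (-β * I)) - exp (β * I) • res A (exp (β * I))) := by
  have hπ : ω < Real.pi := by linarith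
  have hper : exp ((2 * Real.pi - β : ℝ) * I) = exp (-β * I) := by
    rw [show ((2 * Real.pi - β : ℝ) * I : ℂ) = -β * I + 2 * Real.pi * I by push_cast; ring,
      exp_periodic]
  have hshift : lineIntegral (integrand A (basicReg β)) (-θ) =
      lineIntegral (integrand A (basicReg β)) (2 * Real.pi - θ) := by
    unfold lineIntegral integrand logRes
    congr 1
    ext1 t
    rw [show (t + (2 * Real.pi - θ : ℝ) * I : ℂ) = t + (-θ : ℝ) * I + 2 * Real.pi * I by
      push_cast; ring, exp_periodic]
  have e1 := hA.lineIntegral_integrand_sub h0 hπ (a := θ) (b := Real.pi) (γ := β)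
    (e := basicReg β) (ζ := exp (-β * I)) h1 (by linarith) h2 h3
    (by rw [← ofReal_neg, norm_exp_ofReal_mul_I])
    (fun w hw1 hw2 h => by
      obtain ⟨n, hn⟩ := exists_int_im_eq (h.trans hper.symm)
      simp only [mul_im, ofReal_re, I_im, mul_one, ofReal_im, I_re, mul_zero, add_zero] at hn
      rcases le_or_gt n (-1) with h' | h'
      · have : (n : ℝ) ≤ -1 := by exact_mod_cast h'
        nlinarith [Real.pi_pos]
      · have : (0 : ℝ) ≤ n := by exact_mod_cast (by lia : 0 ≤ n)
        nlinarith [Real.pi_pos])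
    (fun z => rfl)
  have e2 := hA.lineIntegral_integrand_sub h0 hπ (a := Real.pi) (b := 2 * Real.pi - θ)
    (γ := 2 * Real.pi - β) (e := basicReg β) (ζ := exp (β * I)) hπ (by linarith) (by linarith)
    (by linarith) (norm_exp_ofReal_mul_I β)
    (fun w hw1 hw2 h => by
      obtain ⟨n, hn⟩ := exists_int_im_eq h
      simp only [mul_im, ofReal_re, I_im, mul_one, ofReal_im, I_re, mul_zero, add_zero] at hn
      rcases le_or_gt n 0 with h' | h'
      · have : (n : ℝ) ≤ 0 := by exact_mod_cast h'
        nlinarith [Real.pi_pos]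
      · have : (1 : ℝ) ≤ n := by exact_mod_cast (by lia : 1 ≤ n)
        nlinarith [Real.pi_pos])
    (fun z => by rw [hper, basicReg, mul_comm (z - _)])
  rw [logRes, hper] at e2
  rw [logRes] at e1
  rw [cauchy_eq, hshift, ← neg_sub (lineIntegral _ θ), ← sub_add_sub_cancel, e1, e2, ← smul_add,
    smul_neg, smul_smul, inv_mul_cancel₀ two_pi_I_ne_zero, one_smul,
    ← neg_sub (exp (β * I)) (exp (-β * I)), inv_neg]
  module

/-- If x is in the kernel, then wR(w)x = zR(z)x at the two poles. Subtracting x from both sides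
gives AR(w)x = AR(z)x, so R(w)x = R(z)x by injectivity of A. As w ≠ z, this vector is 0, and so is
x. -/
theorem IsSect.injective_cauchy_basicReg [CompleteSpace X] (hA : IsSect ω A) (h0 : 0 < ω)
    (hinj : Function.Injective A) {θ β : ℝ} (h1 : ω < θ) (h2 : θ < β) (h3 : β < Real.pi) :
    Function.Injective (cauchy A θ (basicReg β)) := by
  have hne : exp (β * I) ≠ exp (-β * I) := fun h => by
    have := eq_of_exp_eq_exp h (by rw [abs_lt]; simp; constructor <;> linarith)
    have := congrArg im this
    simp at this
    linarith
  have hmem {b : ℝ} (hb : |b| = β) : exp (b * I) ∉ closedSector ω :=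
    exp_mem_compl_closedSector h0 (by linarith) (by simp; linarith) (by simp; linarith)
  have hβ : |β| = β := abs_of_pos (by linarith)
  have hR := hA.isResolvent (hmem hβ)
  have hS := hA.isResolvent (hmem (b := -β) (by rw [abs_neg, hβ]))
  rw [ofReal_neg] at hS
  rw [hA.cauchy_basicReg h0 h1 h2 h3]
  generalize exp (β * I) = z at *
  generalize exp (-β * I) = w at *
  refine (injective_iff_map_eq_zero _).2 fun x hx => ?_
  have hx' : w • res A w x = z • res A z x := by
    have hx : (z - w)⁻¹ • (w • res A w x - z • res A z x) = 0 := hx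
    rw [smul_eq_zero_iff_right (inv_ne_zero (sub_ne_zero.2 hne))] at hx
    exact sub_eq_zero.1 hx
  obtain ⟨hd, hz⟩ := hR.1 x
  obtain ⟨hd', hw⟩ := hS.1 x
  have hAA : A ⟨res A w x, hd'⟩ = A ⟨res A z x, hd⟩ := by
    rw [hx'] at hw
    exact sub_right_injective (hw.trans hz.symm)
  have heq : res A w x = res A z x := congrArg Subtype.val (hinj hAA)
  rw [heq, ← sub_eq_zero, ← sub_smul, smul_eq_zero_iff_right (sub_ne_zero.2 hne.symm)] at hx'
  have h0' : (⟨res A z x, hd⟩ : A.domain) = 0 := Subtype.ext hx'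
  rw [h0', hx', A.map_zero, smul_zero, sub_zero] at hz
  exact hz.symm

/-- Functions of polynomial growth have regularisers; two of them have a common one. -/
theorem IsSect.exists_regulariser [CompleteSpace X] (hA : IsSect ω A) (h0 : 0 < ω)
    (hinj : Function.Injective A) {ψ θ : ℝ} (h1 : ω < θ) (h2 : θ < ψ) (h3 : ψ < Real.pi)
    {f g : ℂ → ℂ} (hf : MemB ψ f) (hg : MemB ψ g) :
    ∃ e : ℂ → ℂ, MemH0 ψ e ∧ MemH0 ψ (e * f) ∧ MemH0 ψ (e * g) ∧
      Function.Injective (cauchy A θ e) := by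
  obtain ⟨β, hβ, hβπ⟩ := exists_between h3
  have hψ : 0 < ψ := by linarith
  obtain ⟨N, hN⟩ := exists_memH0_basicReg_pow_mul hψ hβ hβπ hf
  obtain ⟨N', hN'⟩ := exists_memH0_basicReg_pow_mul hψ hβ hβπ hg
  -- The exponent is at least 1 because the zeroth power does not decay.
  have hpow (n : ℕ) : MemH0 ψ (basicReg β ^ (n + 1)) ∧
      Function.Injective (cauchy A θ (basicReg β ^ (n + 1))) := by
    have hr := memH0_basicReg hψ hβ hβπ
    have hi := hA.injective_cauchy_basicReg h0 hinj h1 (h2.trans hβ) hβπ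
    induction n with
    | zero => simpa using ⟨hr, hi⟩
    | succ n ih =>
      rw [pow_succ, ← cauchy_mul_cauchy hA h0 h3.le ih.1 hr h1 h2]
      exact ⟨ih.1.mul hr, ih.2.comp hi⟩
  exact ⟨basicReg β ^ (max N N' + 1), (hpow _).1, hN _ (by lia), hN' _ (by lia), (hpow _).2⟩

end BasicRegulariser

/-! ### Operators through their graphs; independence of the regulariser. -/

section Graph

variable {X : Type*} [NormedAddCommGroup X] [NormedSpace ℂ X]

theorem mem_graph_mulPMap {S T : X →ₗ.[ℂ] X} {x w : X} :
    (x, w) ∈ (mulPMap S T).graph ↔ ∃ y, (x, y) ∈ T.graph ∧ (y, w) ∈ S.graph := by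
  simp only [LinearPMap.mem_graph_iff]
  constructor
  · rintro ⟨⟨_, ⟨x, hx⟩, hx', rfl⟩, rfl, rfl⟩
    exact ⟨T ⟨x, hx⟩, ⟨⟨x, hx⟩, rfl, rfl⟩, ⟨⟨T ⟨x, hx⟩, hx'⟩, rfl, rfl⟩⟩
  · rintro ⟨_, ⟨x, rfl, rfl⟩, ⟨y, hy, rfl⟩⟩
    have hmem : T x ∈ S.domain := hy ▸ y.2
    refine ⟨⟨x, x, hmem, rfl⟩, rfl, ?_⟩
    exact congrArg S (Subtype.ext hy.symm)

theorem mem_graph_ofCLM {T : X →L[ℂ] X} {x y : X} : (x, y) ∈ (ofCLM T).graph ↔ T x = y := by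
  simp only [LinearPMap.mem_graph_iff]
  exact ⟨by rintro ⟨x, rfl, rfl⟩; rfl, fun h => ⟨⟨x, Submodule.mem_top⟩, rfl, h⟩⟩

theorem mem_graph_inverse_ofCLM {T : X →L[ℂ] X} (hT : Function.Injective T) {x y : X} :
    (x, y) ∈ (ofCLM T).inverse.graph ↔ T y = x := by
  have hker : LinearMap.ker (ofCLM T).toFun = ⊥ :=
    LinearMap.ker_eq_bot.2 fun a b h => Subtype.ext (hT h)
  rw [LinearPMap.inverse_graph hker, ← mem_graph_ofCLM]
  simp

variable {A : X →ₗ.[ℂ] X} {ω : ℝ}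

theorem Regulariser.mem_graph_op {f : ℂ → ℂ} (r : Regulariser ω A f) {x y : X} :
    (x, y) ∈ r.op.graph ↔ cauchy A r.θ (r.e * f) x = cauchy A r.θ r.e y := by
  simp only [op, mem_graph_mulPMap, mem_graph_ofCLM, mem_graph_inverse_ofCLM r.inj]
  exact ⟨by rintro ⟨_, h1, h2⟩; rw [h1, h2], fun h => ⟨_, rfl, h.symm⟩⟩

variable [CompleteSpace X]

/-- The operator given by a regulariser does not depend on the regulariser. -/
theorem Regulariser.mem_graph_op_of_mem_graph_op (hA : IsSect ω A) (h0 : 0 < ω) {f : ℂ → ℂ}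
    (r r' : Regulariser ω A f) {x y : X} (h : (x, y) ∈ r.op.graph) : (x, y) ∈ r'.op.graph := by
  rw [mem_graph_op] at h ⊢
  obtain ⟨θ, h1, h2⟩ := exists_between (lt_min (r.lt_θ.trans r.θ_lt) (r'.lt_θ.trans r'.θ_lt))
  have hψ : min r.ψ r'.ψ ≤ Real.pi := (min_le_left _ _).trans r.ψ_lt.le
  have hle := min_le_left r.ψ r'.ψ
  have hle' := min_le_right r.ψ r'.ψ
  have hc {g : ℂ → ℂ} (hg : MemH0 r.ψ g) : cauchy A r.θ g = cauchy A θ g :=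
    cauchy_eq_cauchy hA h0 r.ψ_lt.le hg r.lt_θ r.θ_lt h1 (h2.trans_le hle)
  have hc' {g : ℂ → ℂ} (hg : MemH0 r'.ψ g) : cauchy A r'.θ g = cauchy A θ g :=
    cauchy_eq_cauchy hA h0 r'.ψ_lt.le hg r'.lt_θ r'.θ_lt h1 (h2.trans_le hle')
  have hinj := r.inj
  rw [hc r.mem, hc r.mem_mul] at h
  rw [hc r.mem] at hinj
  rw [hc' r'.mem, hc' r'.mem_mul]
  have hm {g k : ℂ → ℂ} (hg : MemH0 r.ψ g) (hk : MemH0 r'.ψ k) (z : X) :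
      cauchy A θ g (cauchy A θ k z) = cauchy A θ (g * k) z :=
    congrArg (· z) (cauchy_mul_cauchy hA h0 hψ (hg.mono hle) (hk.mono hle') h1 h2)
  have hm' {g k : ℂ → ℂ} (hg : MemH0 r.ψ g) (hk : MemH0 r'.ψ k) (z : X) :
      cauchy A θ k (cauchy A θ g z) = cauchy A θ (g * k) z := by
    rw [mul_comm]
    exact congrArg (· z) (cauchy_mul_cauchy hA h0 hψ (hk.mono hle') (hg.mono hle) h1 h2)
  -- With e, e' the two regularisers: e(A)(e'f)(A)x = e'(A)(ef)(A)x = e'(A)e(A)y = e(A)e'(A)y, and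
  -- e(A) cancels.
  apply hinj
  rw [hm r.mem r'.mem_mul, hm r.mem r'.mem, ← hm' r.mem r'.mem, ← h, hm' r.mem_mul r'.mem,
    mul_comm r'.e f, mul_assoc]

/-- Replaces the chosen regulariser in `holCalc` by any convenient one; later arguments about f(A)
rest on this. -/
theorem mem_graph_holCalc (hA : IsSect ω A) (h0 : 0 < ω) {ψ θ : ℝ} (h1 : ω < θ) (h2 : θ < ψ)
    (h3 : ψ < Real.pi) {f e : ℂ → ℂ} (hf : DifferentiableOn ℂ f (sector ψ)) (he : MemH0 ψ e)
    (hef : MemH0 ψ (e * f)) (hinj : Function.Injective (cauchy A θ e)) {x y : X} :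
    (x, y) ∈ (holCalc ω A f).graph ↔ cauchy A θ (e * f) x = cauchy A θ e y := by
  let r : Regulariser ω A f := ⟨ψ, θ, e, h1, h2, h3, hf, he, hef, hinj⟩
  have hr : Nonempty (Regulariser ω A f) := ⟨r⟩
  rw [holCalc, dif_pos hr, ← r.mem_graph_op]
  exact ⟨hr.some.mem_graph_op_of_mem_graph_op hA h0 r,
    r.mem_graph_op_of_mem_graph_op hA h0 hr.some⟩

end Graph

/-! ### Sum and product rules of the extended calculus. -/

section Extended

variable {X : Type*} [NormedAddCommGroup X] [NormedSpace ℂ X]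
  {A : X →ₗ.[ℂ] X} {ω ψ : ℝ} {f g : ℂ → ℂ} {x y w : X}

theorem cauchy_add {θ : ℝ} (hA : IsSect ω A) (h0 : 0 < ω) (h1 : ω < θ) (h2 : θ < ψ)
    (h3 : ψ ≤ Real.pi) (hf : MemH0 ψ f) (hg : MemH0 ψ g) :
    cauchy A θ (f + g) = cauchy A θ f + cauchy A θ g := by
  have hθ : |θ| = θ := abs_of_pos (h0.trans h1)
  have h {y : ℝ} (hy : |y| = θ) : lineIntegral (integrand A (f + g)) y =
      lineIntegral (integrand A f) y + lineIntegral (integrand A g) y := by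
    unfold lineIntegral
    rw [← integral_add
      (hf.integrable_integrand hA h0 (h1.trans h2) h3 (by rwa [hy]) (by rwa [hy]))
      (hg.integrable_integrand hA h0 (h1.trans h2) h3 (by rwa [hy]) (by rwa [hy]))]
    simp only [integrand, Pi.add_apply, add_smul]
  rw [cauchy_eq, cauchy_eq, cauchy_eq, h hθ, h (by rwa [abs_neg]), ← smul_add]
  congr 1
  abel

theorem cauchy_const_mul (A : X →ₗ.[ℂ] X) (θ : ℝ) (c : ℂ) (f : ℂ → ℂ) :
    cauchy A θ (fun z => c * f z) = c • cauchy A θ f := by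
  have h (y : ℝ) : lineIntegral (integrand A fun z => c * f z) y =
      c • lineIntegral (integrand A f) y := by
    unfold lineIntegral
    rw [← integral_smul]
    simp only [integrand, mul_smul]
  rw [cauchy_eq, cauchy_eq, h, h, ← smul_sub, smul_comm]

theorem MemHA.mem_graph (hf : MemHA ω A f) (x : X) : (x, hf.op x) ∈ (holCalc ω A f).graph := by
  rw [hf.2.choose_spec]
  exact mem_graph_ofCLM.2 rfl

variable [CompleteSpace X]

/-- Needed because cancellations such as (e₃/f)(fg) = e₃g are known only on the sector, where f has
no zeros. -/
theorem mem_graph_holCalc_congr (hA : IsSect ω A) (h0 : 0 < ω) (hinj : Function.Injective A)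
    (h1 : ω < ψ) (h2 : ψ < Real.pi) (hf : MemB ψ f) (h : EqOn g f (sector ψ)) :
    (x, y) ∈ (holCalc ω A g).graph ↔ (x, y) ∈ (holCalc ω A f).graph := by
  obtain ⟨θ, h3, h4⟩ := exists_between h1
  obtain ⟨e, he, hef, -, hi⟩ := hA.exists_regulariser h0 hinj h3 h4 h2 hf hf
  have heq : EqOn (e * g) (e * f) (sector ψ) := fun z hz => by simp [h hz]
  rw [mem_graph_holCalc hA h0 h3 h4 h2 hf.1 he hef hi,
    mem_graph_holCalc hA h0 h3 h4 h2 (hf.1.congr h) he (hef.congr heq) hi,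
    cauchy_congr (h0.trans h3) h4 h2.le heq]

/-- If `(x, y) ∈ g(A)`, then `(x, w) ∈ (f g)(A)` exactly if `(y, w) ∈ f(A)`. -/
theorem mem_graph_holCalc_mul_iff (hA : IsSect ω A) (h0 : 0 < ω) (hinj : Function.Injective A)
    (h1 : ω < ψ) (h2 : ψ < Real.pi) (hf : MemB ψ f) (hg : MemB ψ g)
    (hx : (x, y) ∈ (holCalc ω A g).graph) :
    (x, w) ∈ (holCalc ω A (f * g)).graph ↔ (y, w) ∈ (holCalc ω A f).graph := by
  obtain ⟨θ, h3, h4⟩ := exists_between h1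
  obtain ⟨e, he, hef, heg, hi⟩ := hA.exists_regulariser h0 hinj h3 h4 h2 hf hg
  have hm {k l : ℂ → ℂ} (hk : MemH0 ψ k) (hl : MemH0 ψ l) :=
    cauchy_mul_cauchy hA h0 h2.le hk hl h3 h4
  have hfg : e * e * (f * g) = e * f * (e * g) := by ring
  have hi' : Function.Injective (cauchy A θ (e * e)) := by
    rw [← hm he he]
    exact hi.comp hi
  rw [mem_graph_holCalc hA h0 h3 h4 h2 hg.1 he heg hi] at hx
  rw [mem_graph_holCalc hA h0 h3 h4 h2 hf.1 he hef hi,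
    mem_graph_holCalc hA h0 h3 h4 h2 (hf.1.mul hg.1) (he.mul he) (hfg ▸ hef.mul heg) hi', hfg,
    ← hm hef heg, ← hm he he]
  change cauchy A θ (e * f) (cauchy A θ (e * g) x) = cauchy A θ e (cauchy A θ e w) ↔ _
  have hcomm : cauchy A θ (e * f) (cauchy A θ e y) = cauchy A θ e (cauchy A θ (e * f) y) := by
    have := (hm hef he).trans ((congrArg (cauchy A θ) (mul_comm _ _)).trans (hm he hef).symm)
    exact congrArg (· y) this
  -- The square of e regularises fg, and (ef)(A)(eg)(A)x = (ef)(A)e(A)y = e(A)(ef)(A)y; one factor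
  -- e(A) cancels from the equation.
  rw [hx, hcomm]
  exact hi.eq_iff

theorem mem_graph_holCalc_add (hA : IsSect ω A) (h0 : 0 < ω) (hinj : Function.Injective A)
    (h1 : ω < ψ) (h2 : ψ < Real.pi) (hf : MemB ψ f) (hg : MemB ψ g)
    (hxf : (x, y) ∈ (holCalc ω A f).graph) (hxg : (x, w) ∈ (holCalc ω A g).graph) :
    (x, y + w) ∈ (holCalc ω A (f + g)).graph := by
  obtain ⟨θ, h3, h4⟩ := exists_between h1
  obtain ⟨e, he, hef, heg, hi⟩ := hA.exists_regulariser h0 hinj h3 h4 h2 hf hg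
  rw [mem_graph_holCalc hA h0 h3 h4 h2 hf.1 he hef hi] at hxf
  rw [mem_graph_holCalc hA h0 h3 h4 h2 hg.1 he heg hi] at hxg
  rw [mem_graph_holCalc hA h0 h3 h4 h2 (hf.1.add hg.1) he (mul_add e f g ▸ hef.add heg) hi,
    mul_add, cauchy_add hA h0 h3 h4 h2.le hef heg, map_add, ← hxf, ← hxg]
  rfl

theorem mem_graph_holCalc_const (hA : IsSect ω A) (h0 : 0 < ω) (hinj : Function.Injective A)
    (h1 : ω < ψ) (h2 : ψ < Real.pi) (c : ℂ) (x : X) :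
    (x, c • x) ∈ (holCalc ω A fun _ => c).graph := by
  obtain ⟨θ, h3, h4⟩ := exists_between h1
  have hc := memB_const ψ c
  obtain ⟨e, he, hec, -, hi⟩ := hA.exists_regulariser h0 hinj h3 h4 h2 hc hc
  have heq : (e * fun _ => c) = fun z => c * e z := by
    ext z
    exact mul_comm _ _
  rw [mem_graph_holCalc hA h0 h3 h4 h2 hc.1 he hec hi, heq, cauchy_const_mul, map_smul]
  rfl

theorem MemHA.mem_graph_polynomial (hA : IsSect ω A) (h0 : 0 < ω) (hinj : Function.Injective A)
    (h1 : ω < ψ) (h2 : ψ < Real.pi) (hf : MemHA ω A f) (hfψ : MemB ψ f) (q : Polynomial ℂ)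
    (x : X) : (x, Polynomial.aeval hf.op q x) ∈ (holCalc ω A fun z => q.eval (f z)).graph := by
  induction q using Polynomial.induction_on' with
  | add p q hp hq =>
    simp only [Polynomial.eval_add, map_add]
    exact mem_graph_holCalc_add hA h0 hinj h1 h2 (hfψ.polynomial_eval p) (hfψ.polynomial_eval q)
      hp hq
  | monomial n a =>
    induction n generalizing x with
    | zero => simpa [Algebra.algebraMap_eq_smul_one] using
        mem_graph_holCalc_const hA h0 hinj h1 h2 a x
    | succ n ih =>
      have heq : (fun z => (Polynomial.monomial (n + 1) a).eval (f z)) =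
          (fun z => (Polynomial.monomial n a).eval (f z)) * f := by
        ext z
        simp [pow_succ, mul_assoc]
      rw [heq, mem_graph_holCalc_mul_iff hA h0 hinj h1 h2 (hfψ.polynomial_eval _) hfψ
        (hf.mem_graph x)]
      convert ih (hf.op x) using 2
      simp [Polynomial.aeval_monomial, pow_succ]

end Extended

/-! ### The domain inclusion. -/

section Product

variable {X : Type*} [NormedAddCommGroup X] [NormedSpace ℂ X] [CompleteSpace X]
  {A : X →ₗ.[ℂ] X} {ω ψ : ℝ} {g e₁ e₂ e₃ : ℂ → ℂ}

/-- If `p(e₃(A))` maps into the range of `(e₁ e₂)(A)` and `(e₂ g)(A)` is bounded, then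
`((p ∘ e₃) g)(A)` is everywhere defined. -/
theorem exists_mem_graph_mul_of_range_le (hA : IsSect ω A) (h0 : 0 < ω)
    (hinj : Function.Injective A) (h1 : ω < ψ) (h2 : ψ < Real.pi) (hg : MemB ψ g)
    (he₁ : MemHA ω A e₁) (he₃ : MemHA ω A e₃)
    (hb₁ : MemB ψ e₁) (hb₂ : MemB ψ e₂) (hb₃ : MemB ψ e₃) (hg₂ : MemHA ω A (e₂ * g))
    (p : Polynomial ℂ)
    (hran : LinearMap.range (Polynomial.aeval he₃.op p).toLinearMap ≤
      LinearMap.range (holCalc ω A (e₁ * e₂)).toFun) (x : X) :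
    ∃ v, (x, v) ∈ (holCalc ω A (g * fun z => p.eval (e₃ z))).graph := by
  have hxp := he₃.mem_graph_polynomial hA h0 hinj h1 h2 hb₃ p x
  obtain ⟨y, hy⟩ := hran ⟨x, rfl⟩
  -- The factors are swapped so that the bounded operator e₁(A) acts first; the product rule then
  -- yields e₂(A)e₁(A)y = p(e₃(A))x.
  have hy' : ((y : X), Polynomial.aeval he₃.op p x) ∈ (holCalc ω A (e₂ * e₁)).graph := by
    rw [mul_comm]
    exact (LinearPMap.mem_graph_iff _).2 ⟨y, rfl, hy⟩
  rw [mem_graph_holCalc_mul_iff hA h0 hinj h1 h2 hb₂ hb₁ (he₁.mem_graph _)] at hy'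
  obtain ⟨v, hv⟩ : ∃ v, (he₁.op y, v) ∈ (holCalc ω A (g * e₂)).graph := by
    rw [mul_comm]
    exact ⟨_, hg₂.mem_graph _⟩
  -- Now g(A) sends e₂(A)e₁(A)y = p(e₃(A))x to v.
  rw [mem_graph_holCalc_mul_iff hA h0 hinj h1 h2 hg hb₂ hy'] at hv
  exact ⟨_, (mem_graph_holCalc_mul_iff hA h0 hinj h1 h2 hg (hb₃.polynomial_eval p) hxp).2 hv⟩

/-- If `((p ∘ e) g)(A)` is everywhere defined and `p(0) ≠ 0`, then `g(A)` is defined wherever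
`(e g)(A)` is. -/
theorem exists_mem_graph_of_mem_graph_mul (hA : IsSect ω A) (h0 : 0 < ω)
    (hinj : Function.Injective A) (h1 : ω < ψ) (h2 : ψ < Real.pi) (hg : MemB ψ g) {e : ℂ → ℂ}
    (he : MemHA ω A e) (hb : MemB ψ e) {p : Polynomial ℂ} (hp : p.eval 0 ≠ 0) {x u v : X}
    (hu : (x, u) ∈ (holCalc ω A (e * g)).graph)
    (hv : (x, v) ∈ (holCalc ω A (g * fun z => p.eval (e z))).graph) :
    ∃ y, (x, y) ∈ (holCalc ω A g).graph := by
  -- `p.divX` is q in p(z) = p(0) + z q(z); the sign prepares p(0)g = (p∘e)g + (−q∘e)(eg).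
  have hmono := hb.polynomial_eval (-p.divX)
  have hq := (mem_graph_holCalc_mul_iff hA h0 hinj h1 h2 hmono (hb.mul hg) hu).2
    (he.mem_graph_polynomial hA h0 hinj h1 h2 hb (-p.divX) u)
  have hsum := mem_graph_holCalc_add hA h0 hinj h1 h2 (hg.mul (hb.polynomial_eval p))
    (hmono.mul (hb.mul hg)) hv hq
  have hc := (mem_graph_holCalc_mul_iff hA h0 hinj h1 h2 (memB_const ψ (p.eval 0)⁻¹)
    ((hg.mul (hb.polynomial_eval p)).add (hmono.mul (hb.mul hg))) hsum).2
    (mem_graph_holCalc_const hA h0 hinj h1 h2 (p.eval 0)⁻¹ _)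
  refine ⟨_, (mem_graph_holCalc_congr hA h0 hinj h1 h2 hg fun z _ => ?_).1 hc⟩
  have hpz : p.eval (e z) = p.divX.eval (e z) * e z + p.eval 0 := by
    conv_lhs => rw [← p.divX_mul_X_add]
    simp [Polynomial.coeff_zero_eq_eval_zero]
  simp only [Pi.mul_apply, Pi.add_apply, Polynomial.eval_neg, hpz]
  field_simp
  ring

end Product

end SectCalc

theorem theorem3p1 {X : Type*} [NormedAddCommGroup X] [NormedSpace ℂ X] [CompleteSpace X]
    (ω φ : ℝ) (hω : 0 < ω) (hωφ : ω < φ) (hφ : φ < Real.pi)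
    (A : X →ₗ.[ℂ] X) (hA : SectCalc.IsSect ω A) (hinj : Function.Injective A)
    (f g : ℂ → ℂ) (hf : SectCalc.MemB φ f) (hg : SectCalc.MemB φ g)
    (hf0 : ∀ z ∈ SectCalc.sector φ, f z ≠ 0) (hf1 : SectCalc.MemB φ f⁻¹)
    (e₁ e₂ e₃ : ℂ → ℂ)
    (he₁ : SectCalc.MemHA ω A e₁) (he₂ : SectCalc.MemHA ω A e₂) (he₃ : SectCalc.MemHA ω A e₃)
    (p : Polynomial ℂ) (hp : p.eval 0 ≠ 0)
    (he₁0 : ∀ z ∈ SectCalc.sector φ, e₁ z ≠ 0) (he₁1 : SectCalc.MemB φ e₁⁻¹)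
    (he₂0 : ∀ z ∈ SectCalc.sector φ, e₂ z ≠ 0) (he₂1 : SectCalc.MemB φ e₂⁻¹)
    (he₃0 : ∀ z ∈ SectCalc.sector φ, e₃ z ≠ 0) (he₃1 : SectCalc.MemB φ e₃⁻¹)
    (h₁ : SectCalc.MemHA ω A (e₁ * f)) (h₂ : SectCalc.MemHA ω A (e₂ * g))
    (h₃ : SectCalc.MemHA ω A (e₃ / f))
    (hran : LinearMap.range (Polynomial.aeval he₃.op p).toLinearMap ≤
      LinearMap.range (SectCalc.holCalc ω A (e₁ * e₂)).toFun) :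
    SectCalc.mulPMap (SectCalc.holCalc ω A f) (SectCalc.holCalc ω A g) =
      SectCalc.holCalc ω A (f * g) := by
  open SectCalc in
  obtain ⟨ψ₁, hω₁, -, hb₁⟩ := he₁.1
  obtain ⟨ψ₂, hω₂, -, hb₂⟩ := he₂.1
  obtain ⟨ψ₃, hω₃, -, hb₃⟩ := he₃.1
  -- Each eⱼ has polynomial growth only on a sector of its own; everything is restricted to one
  -- common smaller sector.
  obtain ⟨ψ, h1, hlt⟩ := exists_between (lt_min (lt_min hωφ hω₁) (lt_min hω₂ hω₃))
  simp only [lt_min_iff] at hlt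
  obtain ⟨⟨hψ, hψ₁⟩, hψ₂, hψ₃⟩ := hlt
  have h2 : ψ < Real.pi := hψ.trans hφ
  replace hf := hf.mono hψ.le
  replace hg := hg.mono hψ.le
  replace hb₃ := hb₃.mono hψ₃.le
  have hdiv : MemB ψ (e₃ / f) := by
    rw [div_eq_mul_inv]
    exact hb₃.mul (hf1.mono hψ.le)
  refine LinearPMap.eq_of_eq_graph (SetLike.ext fun ⟨x, w⟩ => ?_)
  rw [mem_graph_mulPMap]
  constructor
  · rintro ⟨y, hxy, hyw⟩
    exact (mem_graph_holCalc_mul_iff hA hω hinj h1 h2 hf hg hxy).2 hyw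
  · intro hxw
    -- Applying the bounded operator (e₃/f)(A) to w = (fg)(A)x puts x into dom (e₃g)(A).
    have hu := (mem_graph_holCalc_mul_iff hA hω hinj h1 h2 hdiv (hf.mul hg) hxw).2
      (h₃.mem_graph w)
    have hu' := (mem_graph_holCalc_congr (g := e₃ / f * (f * g)) hA hω hinj h1 h2 (hb₃.mul hg)
      fun z hz => by
        have := hf0 z (sector_mono hψ.le hz)
        simp only [Pi.mul_apply, Pi.div_apply]
        field_simp).1 hu
    obtain ⟨v, hv⟩ := exists_mem_graph_mul_of_range_le hA hω hinj h1 h2 hg he₁ he₃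
      (hb₁.mono hψ₁.le) (hb₂.mono hψ₂.le) hb₃ h₂ p hran x
    obtain ⟨y, hy⟩ := exists_mem_graph_of_mem_graph_mul hA hω hinj h1 h2 hg he₃ hb₃ hp hu' hv
    exact ⟨y, hy, (mem_graph_holCalc_mul_iff hA hω hinj h1 h2 hf hg hy).1 hxw⟩
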